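/- All Hilbert spaces are finite-dimensional and all entropies are in bits; $\|\cdot\|_1$ is the trace norm. A system $S$ of dimension $d_S$ with an observable $A=\sum_{i=1}^{d_S} a_i|i\rangle\langle i|$ interacts with finitely many environments $E_k$, of which at least one is observed and the others (possibly none) are discarded. The initial state is a product state $\varrho_S\otimes\bigotimes_k\varrho^{(k)}$, and the evolution is $U(t)=\sum_i |i\rangle\langle i|\otimes\bigotimes_k U^{(k)}_i(t)$ with $U^{(k)}_i(t)=e^{-i a_i B_k t}$ for Hermitian operators $B_k$. Let $\varrho(t)$ be the state of $S$ and the observed environments at time $t$, i.e. the partial trace of $U(t)(\varrho_S\otimes\bigotimes_k\varrho^{(k)})U(t)^\dagger$ over the discarded environments. Put $\sigma_{ij}=\langle i|\varrho_S|j\rangle$, $\sigma_i=\sigma_{ii}$, $\varrho^{(k)}_{ij}=U^{(k)}_i(t)\varrho^{(k)}U^{(k)}_j(t)^\dagger$, $\varrho^{(k)}_i=\varrho^{(k)}_{ii}$, and $H_S=-\sum_i\sigma_i\log_2\sigma_i$. A measurement $\mathsf P$ consists of a complete set of mutually orthogonal projectors $\{P^{(k)}_i\}_{i=1}^{d_S}$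 for every observed $k$ (so $\sum_i P^{(k)}_i=1$; some projectors may be $0$). Put $p^{(k)}_i=\mathrm{Tr}[P^{(k)}_i\varrho^{(k)}_iP^{(k)}_i]$ and $r_i=\prod_{k\text{ observed}}p^{(k)}_i$. If $\sum_j\sigma_jr_j\neq0$, put $$\varrho_{SBS}(t;\mathsf P)=\sum_i\frac{\sigma_ir_i}{\sum_j\sigma_jr_j}\,|i\rangle\langle i|\otimes\bigotimes_{k\text{ observed}}\frac{P^{(k)}_i\varrho^{(k)}_iP^{(k)}_i}{p^{(k)}_i},\qquad \varepsilon(t;\mathsf P)=\tfrac12\|\varrho(t)-\varrho_{SBS}(t;\mathsf P)\|_1,$$ where terms with $r_i=0$ are read as $0$. With $B(\varrho,\varrho')=\|\sqrt{\varrho}\sqrt{\varrho'}\|_1$ let $$\eta=\sum_{i\ne j}|\sigma_{ij}|\prod_{k\text{ discarded}}\big|\mathrm{Tr}\,\varrho^{(k)}_{ij}\big|+\sum_{i\neq j}\sqrt{\sigma_i\sigma_j}\sum_{k\text{ observed}}B\big(\varrho^{(k)}_i,\varrho^{(k)}_j\big).$$ Let $I$ be the quantum mutual information of $\varrho(t)$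 between $S$ and the observed environments, $h(x)=-x\log_2x-(1-x)\log_2(1-x)$, and $F(x)=4h(2x)+2h(x)+10x\log_2d_S$ for $0\le x\le\tfrac12$. Then for every $t$: (1) if some measurement $\mathsf P$ satisfies $\varepsilon(t;\mathsf P)\le\tfrac14$, then $F(\varepsilon(t;\mathsf P))$ attains a minimum over the measurements for which it is defined (those with $\sum_j\sigma_jr_j\ne0$ and $\varepsilon(t;\mathsf P)\le\tfrac12$), and $|I-H_S|\le\min_{\mathsf P}F(\varepsilon(t;\mathsf P))$; (2) if $\eta\le\tfrac14$, then $|I-H_S|\le F(\eta)$. -/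

import Mathlib

open scoped Kronecker ComplexOrder

noncomputable section

namespace Broadcast

/-! ### Matrices, states and entropies in finite dimension (all entropies in bits) -/

/-- A quantum state (density matrix): positive semidefinite with unit trace. -/
def IsState {n : Type*} [Fintype n] (ρ : Matrix n n ℂ) : Prop :=
  ρ.PosSemidef ∧ ρ.trace = 1

/-- The trace norm `Tr √(Aᴴ A)`. -/
def traceNorm {n : Type*} [Fintype n] [DecidableEq n] (A : Matrix n n ℂ) : ℝ :=
  (cfc Real.sqrt (A.conjTranspose * A)).trace.re

/-- The fidelity `B(ρ, σ) = ‖√ρ √σ‖₁`. -/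
def fidelity {n : Type*} [Fintype n] [DecidableEq n] (ρ σ : Matrix n n ℂ) : ℝ :=
  traceNorm (cfc Real.sqrt ρ * cfc Real.sqrt σ)

/-- The von Neumann entropy `-Tr (ρ log₂ ρ)`. -/
def vonNeumannEntropy {n : Type*} [Fintype n] [DecidableEq n] (ρ : Matrix n n ℂ) : ℝ :=
  (cfc Real.negMulLog ρ).trace.re / Real.log 2

/-- The Shannon entropy `-∑ pᵢ log₂ pᵢ`. -/
def shannonEntropy {n : Type*} [Fintype n] (p : n → ℝ) : ℝ :=
  (∑ i, Real.negMulLog (p i)) / Real.log 2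

/-- The binary Shannon entropy `-x log₂ x - (1 - x) log₂ (1 - x)`. -/
def binaryEntropy (x : ℝ) : ℝ := Real.binEntropy x / Real.log 2

/-- The partial trace over the second tensor factor. -/
def traceRight {m n : Type*} [Fintype n] (ρ : Matrix (m × n) (m × n) ℂ) : Matrix m m ℂ :=
  Matrix.of fun i j => ∑ x, ρ (i, x) (j, x)

/-- The partial trace over the first tensor factor. -/
def traceLeft {m n : Type*} [Fintype m] (ρ : Matrix (m × n) (m × n) ℂ) : Matrix n n ℂ :=
  Matrix.of fun x y => ∑ i, ρ (i, x) (i, y)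

/-- The quantum mutual information `S(ρ₁) + S(ρ₂) - S(ρ)` of a bipartite state. -/
def mutualInformation {m n : Type*} [Fintype m] [DecidableEq m] [Fintype n] [DecidableEq n]
    (ρ : Matrix (m × n) (m × n) ℂ) : ℝ :=
  vonNeumannEntropy (traceRight ρ) + vonNeumannEntropy (traceLeft ρ) - vonNeumannEntropy ρ

/-- The tensor product `⨂ₖ Aₖ` of a finite family of matrices, in the product basis. -/
def tensor {K : Type*} [Fintype K] {n : K → Type*} (A : ∀ k, Matrix (n k) (n k) ℂ) :
    Matrix (∀ k, n k) (∀ k, n k) ℂ :=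
  Matrix.of fun x y => ∏ k, A k (x k) (y k)

/-- The matrix unit `|i⟩⟨j|`. -/
def ketBra {n : Type*} [DecidableEq n] (i j : n) : Matrix n n ℂ := Matrix.single i j 1

/-- A complete set of projectors `{Pᵢ}`: mutually orthogonal, self-adjoint, summing to one. -/
def IsProjectiveMeasurement {I n : Type*} [Fintype I] [Fintype n] [DecidableEq n]
    (P : I → Matrix n n ℂ) : Prop :=
  (∀ i, IsStarProjection (P i)) ∧ (∀ i j, i ≠ j → P i * P j = 0) ∧ ∑ i, P i = 1

/-! ### The central system model -/

/-- A central system of dimension `dS`, written in the pointer basis (an eigenbasis of `A`), which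
interacts with `m` observed environments (indices `Sum.inl k`) and `l` discarded environments
(indices `Sum.inr k`), the environment `k` having dimension `dE k`, through
`A ⊗ ∑ₖ Bₖ`, and starts in the product state `ρS ⊗ ⨂ₖ ρE k`. -/
structure CentralModel (dS m l : ℕ) (dE : Fin m ⊕ Fin l → ℕ) where
  /-- the eigenvalues of the system observable `A` -/
  a : Fin dS → ℝ
  /-- the environment observables -/
  B : ∀ k, Matrix (Fin (dE k)) (Fin (dE k)) ℂ
  B_hermitian : ∀ k, (B k).IsHermitian
  /-- the initial state of the system -/
  ρS : Matrix (Fin dS) (Fin dS) ℂ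
  ρS_isState : IsState ρS
  /-- the initial states of the environments -/
  ρE : ∀ k, Matrix (Fin (dE k)) (Fin (dE k)) ℂ
  ρE_isState : ∀ k, IsState (ρE k)

/-- Basis labels of the system together with the observed environments. -/
abbrev ObsIndex (dS m l : ℕ) (dE : Fin m ⊕ Fin l → ℕ) : Type :=
  Fin dS × (∀ k : Fin m, Fin (dE (Sum.inl k)))

/-- A family of local measurements: `P k i` is the projector `Pᵢ` of the observer of the
observed environment `k`. -/
abbrev LocalOperators (dS m l : ℕ) (dE : Fin m ⊕ Fin l → ℕ) : Type :=
  ∀ k : Fin m, Fin dS → Matrix (Fin (dE (Sum.inl k))) (Fin (dE (Sum.inl k))) ℂ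

namespace CentralModel

variable {dS m l : ℕ} {dE : Fin m ⊕ Fin l → ℕ} (𝓜 : CentralModel dS m l dE)

/-- The local unitaries `Uᵢ⁽ᵏ⁾(t) = exp(-i aᵢ Bₖ t)`. -/
def localU (t : ℝ) (i : Fin dS) (k : Fin m ⊕ Fin l) : Matrix (Fin (dE k)) (Fin (dE k)) ℂ :=
  NormedSpace.exp ((-Complex.I * (𝓜.a i : ℂ) * (t : ℂ)) • 𝓜.B k)

/-- The global evolution `U(t) = ∑ᵢ |i⟩⟨i| ⊗ ⨂ₖ Uᵢ⁽ᵏ⁾(t)`. -/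
def evolution (t : ℝ) :
    Matrix (Fin dS × (∀ k, Fin (dE k))) (Fin dS × (∀ k, Fin (dE k))) ℂ :=
  ∑ i, ketBra i i ⊗ₖ tensor (𝓜.localU t i)

/-- The state `U(t) (ρS ⊗ ⨂ₖ ρE k) U(t)†` of the system and all the environments. -/
def globalState (t : ℝ) :
    Matrix (Fin dS × (∀ k, Fin (dE k))) (Fin dS × (∀ k, Fin (dE k))) ℂ :=
  𝓜.evolution t * (𝓜.ρS ⊗ₖ tensor 𝓜.ρE) * (𝓜.evolution t).conjTranspose

/-- The state of the system and the observed environments: the partial trace of the global state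
over the discarded environments. -/
def obsState (t : ℝ) : Matrix (ObsIndex dS m l dE) (ObsIndex dS m l dE) ℂ :=
  Matrix.of fun p q => ∑ z : (∀ k : Fin l, Fin (dE (Sum.inr k))),
    𝓜.globalState t
      (p.1, (Equiv.sumPiEquivProdPi fun k => Fin (dE k)).symm (p.2, z))
      (q.1, (Equiv.sumPiEquivProdPi fun k => Fin (dE k)).symm (q.2, z))

/-- The pointer probabilities `σᵢ = ⟨i|ρS|i⟩`. -/
def σ (i : Fin dS) : ℝ := (𝓜.ρS i i).re

/-- The operators `Uᵢ⁽ᵏ⁾(t) ρE k Uⱼ⁽ᵏ⁾(t)†`. -/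
def envOp (t : ℝ) (i j : Fin dS) (k : Fin m ⊕ Fin l) : Matrix (Fin (dE k)) (Fin (dE k)) ℂ :=
  𝓜.localU t i k * 𝓜.ρE k * (𝓜.localU t j k).conjTranspose

/-- The conditional states `ρᵢ⁽ᵏ⁾(t)` of the environments. -/
def envState (t : ℝ) (i : Fin dS) (k : Fin m ⊕ Fin l) : Matrix (Fin (dE k)) (Fin (dE k)) ℂ :=
  𝓜.envOp t i i k

/-- The collective decoherence factor `Γ(t) = ∑_{i ≠ j} |σᵢⱼ| ∏ₖ |γᵢⱼ⁽ᵏ⁾(t)|`, the product being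
over the discarded environments. -/
def Gam (t : ℝ) : ℝ :=
  ∑ i, ∑ j, if i = j then 0 else
    ‖𝓜.ρS i j‖ * ∏ k : Fin l, ‖(𝓜.envOp t i j (Sum.inr k)).trace‖

/-- `η = Γ(t) + ∑_{i ≠ j} √(σᵢ σⱼ) ∑ₖ B(ρᵢ⁽ᵏ⁾(t), ρⱼ⁽ᵏ⁾(t))`, the last sum being over the
observed environments. -/
def eta (t : ℝ) : ℝ :=
  𝓜.Gam t + ∑ i, ∑ j, if i = j then 0 else
    Real.sqrt (𝓜.σ i * 𝓜.σ j) *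
      ∑ k : Fin m, fidelity (𝓜.envState t i (Sum.inl k)) (𝓜.envState t j (Sum.inl k))

/-- The projected, unnormalized state `Pᵢ⁽ᵏ⁾ ρᵢ⁽ᵏ⁾(t) Pᵢ⁽ᵏ⁾`. -/
def projected (t : ℝ) (P : LocalOperators dS m l dE) (i : Fin dS) (k : Fin m) :
    Matrix (Fin (dE (Sum.inl k))) (Fin (dE (Sum.inl k))) ℂ :=
  P k i * 𝓜.envState t i (Sum.inl k) * P k i

/-- The probability `pᵢ⁽ᵏ⁾(t) = Tr (Pᵢ⁽ᵏ⁾ ρᵢ⁽ᵏ⁾(t) Pᵢ⁽ᵏ⁾)`. -/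
def prob (t : ℝ) (P : LocalOperators dS m l dE) (i : Fin dS) (k : Fin m) : ℝ :=
  (𝓜.projected t P i k).trace.re

/-- The probability `rᵢ(t) = ∏ₖ pᵢ⁽ᵏ⁾(t)` that all the observers see `i`. -/
def r (t : ℝ) (P : LocalOperators dS m l dE) (i : Fin dS) : ℝ := ∏ k, 𝓜.prob t P i k

/-- The total success probability `∑ⱼ σⱼ rⱼ(t)`. -/
def success (t : ℝ) (P : LocalOperators dS m l dE) : ℝ := ∑ j, 𝓜.σ j * 𝓜.r t P j

/-- The spectrum broadcast structure
`∑ᵢ pᵢ |i⟩⟨i| ⊗ ⨂ₖ (Pᵢ⁽ᵏ⁾ ρᵢ⁽ᵏ⁾ Pᵢ⁽ᵏ⁾ / pᵢ⁽ᵏ⁾)` with `pᵢ = σᵢ rᵢ / ∑ⱼ σⱼ rⱼ`. It is meaningful when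
`∑ⱼ σⱼ rⱼ ≠ 0`; a term in which some `pᵢ⁽ᵏ⁾` vanishes has weight `pᵢ = 0`. -/
def sbsState (t : ℝ) (P : LocalOperators dS m l dE) :
    Matrix (ObsIndex dS m l dE) (ObsIndex dS m l dE) ℂ :=
  ∑ i, ((𝓜.σ i * 𝓜.r t P i / 𝓜.success t P : ℝ) : ℂ) •
    (ketBra i i ⊗ₖ tensor fun k => ((𝓜.prob t P i k : ℂ))⁻¹ • 𝓜.projected t P i k)

/-- The family `P` consists of complete sets of projectors, and the spectrum broadcast structure
built from it is defined. -/
def Admissible (t : ℝ) (P : LocalOperators dS m l dE) : Prop :=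
  (∀ k, IsProjectiveMeasurement (P k)) ∧ 𝓜.success t P ≠ 0

/-- The trace distance `ε(t; P)` of the observed state to its spectrum broadcast structure. -/
def eps (t : ℝ) (P : LocalOperators dS m l dE) : ℝ :=
  1 / 2 * traceNorm (𝓜.obsState t - 𝓜.sbsState t P)

/-- The entropy `H_S` of the decohered system state: the Shannon entropy of `(σᵢ)`. -/
def pointerEntropy : ℝ := shannonEntropy 𝓜.σ

end CentralModel

/-- `F(x) = 4 h(2x) + 2 h(x) + 10 x log₂ dS`. -/
def F (dS : ℕ) (x : ℝ) : ℝ :=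
  4 * binaryEntropy (2 * x) + 2 * binaryEntropy x + 10 * x * Real.logb 2 dS

end Broadcast

end

noncomputable section

set_option linter.unusedSectionVars false

namespace Broadcast

/-! Let G(A) = S(A_S) - H(diag A_S) + S(A_E) - S(A) in nats (`broadcastGap`), defined on all
positive matrices, normalised or not. On ρ(t) the diagonal of the system marginal is (σ_i), so G =
(I - H_S) log 2. Write δ for `defect`. By subadditivity and concavity of the entropy, G(A+B) differs
from G(A) + G(B) by at most 2δ(tr A, tr B), and G(A) lies between -2 log d_S and log d_S times tr A.
If two states satisfy ρ + X = τ + Y with X, Y positive of trace at most x, evaluating G on the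
common sum gives |G(ρ) - G(τ)| ≤ 4δ(1,x) + 3x log d_S (`abs_broadcastGap_sub_le`). Such X, Y come
from any factorisation of ρ - τ into products L Rᴴ (`exists_posSemidef_decomposition`). For (1), G
vanishes on a spectrum broadcast structure, whose conditional environment states are orthogonal
(`broadcastGap_sbsState`), and x = ε. The minimum exists because ε ≤ 1/2 forces Σ σ_j r_j ≥ 1/2,
which cuts out a compact set on which ε is continuous. For (2), ρ(t) is compared with its dephased
version at cost Γ. With K_i = √(σ_i ⊗ρ_i), the gap of the dephased state is minus the coherence of
the Gram matrix of the K_i (`broadcastGap_dephase`). That matrix is a state with the same diagonal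
blocks and off-diagonal blocks K_i K_j, controlled by the fidelities. Coherence obeys the same kind
of continuity bound and vanishes on block diagonal states. So no measurement has to be constructed
from the fidelities. `abs_div_log_two_le_F` turns both estimates into F. -/

open Matrix Real


/-! ### Classical entropy inequalities for unnormalised weights. -/

section Classical

variable {ι κ : Type*} [Fintype ι] [Fintype κ]

/-- Subadditivity of Shannon entropy, with a total-mass term replacing normalisation. It is Gibbs'
inequality: log u ≤ u - 1 at u = c r / (a s), whose right-hand sides sum to zero. -/
theorem sum_sum_negMulLog_add_le (a : ι → κ → ℝ) (ha : ∀ i k, 0 ≤ a i k) :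
    ∑ i, ∑ k, negMulLog (a i k) + negMulLog (∑ i, ∑ k, a i k) ≤
      ∑ k, negMulLog (∑ i, a i k) + ∑ i, negMulLog (∑ k, a i k) := by
  set s := ∑ i, ∑ k, a i k with hs
  set c : κ → ℝ := fun k => ∑ i, a i k with hc
  set r : ι → ℝ := fun i => ∑ k, a i k with hr
  have hs' : ∑ k, c k = s := by rw [hs, Finset.sum_comm]
  have hc0 : ∀ k, 0 ≤ c k := fun k => Finset.sum_nonneg fun i _ => ha i k
  have hr0 : ∀ i, 0 ≤ r i := fun i => Finset.sum_nonneg fun k _ => ha i k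
  have hs0 : 0 ≤ s := Finset.sum_nonneg fun i _ => hr0 i
  have key : ∀ i k, a i k * (log (c k) + log (r i) - log (a i k) - log s) ≤
      c k * r i / s - a i k := by
    intro i k
    rcases (ha i k).eq_or_lt with h | h
    · rw [← h]; have := hc0 k; have := hr0 i; simp; positivity
    · have h1 : 0 < c k := h.trans_le (Finset.single_le_sum (f := fun i => a i k)
        (fun i _ => ha i k) (Finset.mem_univ i))
      have h2 : 0 < r i := h.trans_le (Finset.single_le_sum (f := fun k => a i k)
        (fun k _ => ha i k) (Finset.mem_univ k))
      have h3 : 0 < s := h2.trans_le (Finset.single_le_sum (f := r)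
        (fun i _ => hr0 i) (Finset.mem_univ i))
      have := log_le_sub_one_of_pos (x := c k * r i / (a i k * s)) (by positivity)
      rw [log_div (by positivity) (by positivity), log_mul h1.ne' h2.ne',
        log_mul h.ne' h3.ne'] at this
      calc _ ≤ a i k * (c k * r i / (a i k * s) - 1) := mul_le_mul_of_nonneg_left (by linarith) h.le
        _ = _ := by field_simp
  have hsum := Finset.sum_le_sum fun i (_ : i ∈ Finset.univ) =>
    Finset.sum_le_sum fun k (_ : k ∈ Finset.univ) => key i k
  have hR : ∑ i, ∑ k, (c k * r i / s - a i k) = 0 := by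
    simp only [Finset.sum_sub_distrib]
    rw [← hs]
    have : ∑ i, ∑ k, c k * r i / s = s * s / s := by
      simp only [← Finset.sum_div, ← Finset.sum_mul, ← Finset.mul_sum, hs']
      rfl
    -- s * s / s = s holds for s = 0 too, so zero total mass needs no separate case.
    rw [this, mul_self_div_self, sub_self]
  rw [hR] at hsum
  have e1 : ∑ i, ∑ k, a i k * log (c k) = - ∑ k, negMulLog (c k) := by
    rw [Finset.sum_comm]
    simp [negMulLog, ← Finset.sum_mul, hc]
  have e2 : ∑ i, ∑ k, a i k * log (r i) = - ∑ i, negMulLog (r i) := by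
    simp [negMulLog, ← Finset.sum_mul, hr]
  have e3 : ∑ i, ∑ k, a i k * log (a i k) = - ∑ i, ∑ k, negMulLog (a i k) := by
    simp [negMulLog]
  have e4 : ∑ i, ∑ k, a i k * log s = - negMulLog s := by
    simp only [negMulLog, ← Finset.sum_mul, neg_mul, neg_neg]
    rw [hs]
  simp only [mul_sub, mul_add, Finset.sum_sub_distrib, Finset.sum_add_distrib, e1, e2, e3, e4]
    at hsum
  linarith

theorem negMulLog_sum_le (a : ι → ℝ) (ha : ∀ i, 0 ≤ a i) :
    negMulLog (∑ i, a i) ≤ ∑ i, negMulLog (a i) := by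
  have : ∀ i, a i * log (a i) ≤ a i * log (∑ j, a j) := by
    intro i
    rcases (ha i).eq_or_lt with h | h
    · simp [← h]
    · gcongr
      exact Finset.single_le_sum (fun i _ => ha i) (Finset.mem_univ i)
  have := Finset.sum_le_sum fun i (_ : i ∈ Finset.univ) => this i
  rw [← Finset.sum_mul] at this
  simp only [negMulLog, neg_mul, Finset.sum_neg_distrib]
  linarith

theorem sum_negMulLog_le (a : ι → ℝ) (ha : ∀ i, 0 ≤ a i) :
    ∑ i, negMulLog (a i) ≤ negMulLog (∑ i, a i) + (∑ i, a i) * log (Fintype.card ι) := by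
  set s := ∑ i, a i with hs
  rcases isEmpty_or_nonempty ι with h | h
  · simp [hs]
  have hd : 0 < (Fintype.card ι : ℝ) := by exact_mod_cast Fintype.card_pos
  have key : ∀ i, a i * (log s - log (a i) - log (Fintype.card ι)) ≤ s / Fintype.card ι - a i := by
    intro i
    have hs0 : 0 ≤ s := Finset.sum_nonneg fun i _ => ha i
    rcases (ha i).eq_or_lt with h | h
    · rw [← h]; simp; positivity
    · have h3 : 0 < s := h.trans_le (Finset.single_le_sum (fun i _ => ha i) (Finset.mem_univ i))
      have := log_le_sub_one_of_pos (x := s / (a i * Fintype.card ι)) (by positivity)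
      rw [log_div (by positivity) (by positivity), log_mul h.ne' hd.ne'] at this
      calc _ ≤ a i * (s / (a i * Fintype.card ι) - 1) := mul_le_mul_of_nonneg_left (by linarith) h.le
        _ = _ := by field_simp
  have hsum := Finset.sum_le_sum fun i (_ : i ∈ Finset.univ) => key i
  have hR : ∑ i, (s / Fintype.card ι - a i) = 0 := by
    simp [Finset.sum_sub_distrib, ← hs]; field_simp; simp
  have e : ∑ i, a i * log (a i) = - ∑ i, negMulLog (a i) := by simp [negMulLog]
  rw [hR] at hsum
  simp only [mul_sub, Finset.sum_sub_distrib, ← Finset.sum_mul, e, ← hs] at hsum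
  simp only [negMulLog, neg_mul] at *
  linarith

/-- The defect of additivity of `negMulLog`. -/
def defect (a b : ℝ) : ℝ := negMulLog a + negMulLog b - negMulLog (a + b)

/-- Classical subadditivity for the array with the two rows `a` and `b`. -/
theorem sum_defect_le (a b : ι → ℝ) (ha : ∀ i, 0 ≤ a i) (hb : ∀ i, 0 ≤ b i) :
    ∑ i, defect (a i) (b i) ≤ defect (∑ i, a i) (∑ i, b i) := by
  have := sum_sum_negMulLog_add_le ![a, b] (by intro i k; fin_cases i <;> simp [ha, hb])
  simp only [Fin.sum_univ_two, cons_val_zero, cons_val_one] at this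
  simp only [defect, Finset.sum_add_distrib, Finset.sum_sub_distrib]
  linarith

theorem defect_nonneg {a b : ℝ} (ha : 0 ≤ a) (hb : 0 ≤ b) : 0 ≤ defect a b := by
  have := negMulLog_sum_le ![a, b] (by intro i; fin_cases i <;> simpa)
  simp only [Fin.sum_univ_two, cons_val_zero, cons_val_one] at this
  unfold defect
  linarith

/-- Superadditivity over the two cells (a, b) and (0, c - b), the second having defect zero. -/
theorem defect_mono_right {a b c : ℝ} (ha : 0 ≤ a) (hb : 0 ≤ b) (hbc : b ≤ c) :
    defect a b ≤ defect a c := by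
  have := sum_defect_le ![a, 0] ![b, c - b] (by intro i; fin_cases i <;> simp [ha])
    (by intro i; fin_cases i <;> simp [hb, hbc])
  simpa [defect] using this

end Classical

section Real

variable {n : Type*} [Fintype n]

theorem re_diag_nonneg {n : Type*} {A : Matrix n n ℂ} (hA : A.PosSemidef) (i : n) :
    0 ≤ (A i i).re := (Complex.le_def.1 (hA.diag_nonneg (i := i))).1

theorem re_trace_nonneg {A : Matrix n n ℂ} (hA : A.PosSemidef) :
    0 ≤ A.trace.re := (Complex.le_def.1 hA.trace_nonneg).1

theorem trace_re (A : Matrix n n ℂ) : A.trace.re = ∑ i, (A i i).re := by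
  simp [trace]

end Real

/-! ### Spectral calculus and the entropy functional -/

variable {n m ι : Type*} [Fintype n] [DecidableEq n] [Fintype m] [DecidableEq m] [Fintype ι]

/-- The entropy functional `-Tr (A log A)` in nats. -/
def vnEnt (A : Matrix n n ℂ) : ℝ := (cfc negMulLog A).trace.re

theorem exists_diagonalization {A : Matrix n n ℂ} (hA : A.IsHermitian) :
    ∃ U : Matrix n n ℂ, Uᴴ * U = 1 ∧ U * Uᴴ = 1 ∧
      A = U * diagonal (fun i => (hA.eigenvalues i : ℂ)) * Uᴴ ∧ ∀ f : ℝ → ℝ,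
      cfc f A = U * diagonal (fun i => (f (hA.eigenvalues i) : ℂ)) * Uᴴ := by
  refine ⟨hA.eigenvectorUnitary, ?_, ?_, ?_, fun f => ?_⟩
  · exact Unitary.coe_star_mul_self hA.eigenvectorUnitary
  · exact Unitary.coe_mul_star_self hA.eigenvectorUnitary
  · conv_lhs => rw [hA.spectral_theorem, Unitary.conjStarAlgAut_apply]
    rfl
  · rw [hA.cfc_eq f, IsHermitian.cfc, Unitary.conjStarAlgAut_apply]
    rfl

theorem trace_cfc_re {A : Matrix n n ℂ} (hA : A.IsHermitian) (f : ℝ → ℝ) :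
    (cfc f A).trace.re = ∑ i, f (hA.eigenvalues i) := by
  obtain ⟨U, hU, -, -, h⟩ := exists_diagonalization hA
  rw [h, trace_mul_comm, ← mul_assoc, hU, one_mul, trace_diagonal]
  simp

theorem vnEnt_eq_sum_roots {A : Matrix n n ℂ} (hA : A.IsHermitian) :
    vnEnt A = (A.charpoly.roots.map fun z => negMulLog z.re).sum := by
  rw [vnEnt, trace_cfc_re hA, hA.roots_charpoly_eq_eigenvalues]
  simp

theorem vnEnt_diagonal (d : n → ℝ) :
    vnEnt (diagonal fun i => (d i : ℂ)) = ∑ i, negMulLog (d i) := by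
  have h : (diagonal fun i => (d i : ℂ)).IsHermitian := by
    rw [isHermitian_diagonal_iff]; intro i; simp [IsSelfAdjoint]
  rw [vnEnt_eq_sum_roots h, charpoly_diagonal, Polynomial.roots_prod]
  · simp
  · simp [Finset.prod_ne_zero_iff, Polynomial.X_sub_C_ne_zero]

/-- Both products have the same nonzero spectrum, and surplus zeros contribute `negMulLog 0 = 0`.
This carries entropies of sums over to Gram matrices and back. -/
theorem vnEnt_mul_conjTranspose_self (L : Matrix n m ℂ) : vnEnt (L * Lᴴ) = vnEnt (Lᴴ * L) := by
  rw [vnEnt_eq_sum_roots (isHermitian_mul_conjTranspose_self L),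
    vnEnt_eq_sum_roots (isHermitian_conjTranspose_mul_self L)]
  have h := congrArg (fun p => (p.roots.map fun z : ℂ => negMulLog z.re).sum)
    (charpoly_mul_comm' L Lᴴ)
  beta_reduce at h
  rw [Polynomial.roots_mul, Polynomial.roots_mul] at h
  · have hX : ∀ k : ℕ, ((k • ({0} : Multiset ℂ)).map fun z => negMulLog z.re).sum = 0 := by
      intro k; simp [Multiset.map_nsmul, Multiset.sum_nsmul]
    simpa [hX] using h
  · exact mul_ne_zero (pow_ne_zero _ Polynomial.X_ne_zero) (charpoly_monic _).ne_zero
  · exact mul_ne_zero (pow_ne_zero _ Polynomial.X_ne_zero) (charpoly_monic _).ne_zero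

theorem vnEnt_unitary_conj {A U : Matrix n n ℂ} (hA : A.IsHermitian) (hU : U * Uᴴ = 1) :
    vnEnt (Uᴴ * A * U) = vnEnt A := by
  rw [vnEnt_eq_sum_roots hA, vnEnt_eq_sum_roots (isHermitian_conjTranspose_mul_mul U hA),
    charpoly_mul_comm, ← mul_assoc, hU, one_mul]

/-- The diagonal is the image of the spectrum under the doubly stochastic matrix |U_ij|², so
Jensen's inequality applies. -/
theorem vnEnt_le_sum_diag {A : Matrix n n ℂ} (hA : A.PosSemidef) :
    vnEnt A ≤ ∑ i, negMulLog (A i i).re := by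
  obtain ⟨U, h1, h2, hid, -⟩ := exists_diagonalization hA.1
  have hrow : ∀ i, ∑ j, ‖U i j‖ ^ 2 = 1 := by
    intro i
    have := congrArg (fun M => (M i i).re) h2
    simpa [mul_apply, Complex.mul_conj, Complex.normSq_eq_norm_sq, -Complex.ofReal_pow] using this
  have hcol : ∀ j, ∑ i, ‖U i j‖ ^ 2 = 1 := by
    intro j
    have := congrArg (fun M => (M j j).re) h1
    simpa [mul_apply, mul_comm, Complex.mul_conj, Complex.normSq_eq_norm_sq,
      -Complex.ofReal_pow] using this
  have hdiag : ∀ i, (A i i).re = ∑ j, ‖U i j‖ ^ 2 * hA.1.eigenvalues j := by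
    intro i
    have : (A i i).re = _ := congrArg (fun M => (M i i).re) hid
    rw [this, mul_apply, Complex.re_sum]
    refine Finset.sum_congr rfl fun j _ => ?_
    rw [mul_diagonal, conjTranspose_apply, mul_right_comm, ← starRingEnd_apply, Complex.mul_conj,
      Complex.normSq_eq_norm_sq, ← Complex.ofReal_mul, Complex.ofReal_re]
  rw [vnEnt, trace_cfc_re hA.1]
  calc ∑ j, negMulLog (hA.1.eigenvalues j)
      = ∑ i, ∑ j, ‖U i j‖ ^ 2 * negMulLog (hA.1.eigenvalues j) := by
        rw [Finset.sum_comm]; simp [← Finset.sum_mul, hcol]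
    _ ≤ _ := Finset.sum_le_sum fun i _ => by
        rw [hdiag]
        exact concaveOn_negMulLog.le_map_sum (fun j _ => sq_nonneg _) (hrow i)
          fun j _ => hA.eigenvalues_nonneg j

/-- The columns of L are the eigenvectors scaled by the roots of their eigenvalues. -/
theorem exists_factor {A : Matrix n n ℂ} (hA : A.PosSemidef) :
    ∃ L : Matrix n n ℂ, L * Lᴴ = A ∧ ∀ i j, (Lᴴ * L) i j =
      if i = j then (hA.1.eigenvalues i : ℂ) else 0 := by
  obtain ⟨U, h1, h2, hid, -⟩ := exists_diagonalization hA.1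
  have hs : ∀ i, ((√(hA.1.eigenvalues i) : ℝ) : ℂ) * (√(hA.1.eigenvalues i) : ℝ) =
      hA.1.eigenvalues i := fun i => by
    rw [← Complex.ofReal_mul, Real.mul_self_sqrt (hA.eigenvalues_nonneg i)]
  have hd : (diagonal fun i => ((√(hA.1.eigenvalues i) : ℝ) : ℂ))ᴴ =
      diagonal fun i => ((√(hA.1.eigenvalues i) : ℝ) : ℂ) := by
    rw [diagonal_conjTranspose]; congr 1; ext i; simp
  refine ⟨U * diagonal (fun i => ((√(hA.1.eigenvalues i) : ℝ) : ℂ)), ?_, fun i j => ?_⟩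
  · rw [conjTranspose_mul, hd, mul_assoc, ← mul_assoc _ _ Uᴴ, diagonal_mul_diagonal]
    simp only [hs]
    rw [← mul_assoc]
    exact hid.symm
  · rw [conjTranspose_mul, hd, mul_assoc, ← mul_assoc Uᴴ, h1, one_mul, diagonal_mul_diagonal]
    simp only [hs, diagonal_apply]

theorem exists_eq_mul_conjTranspose {A : Matrix n n ℂ} (hA : A.PosSemidef) :
    ∃ L : Matrix n n ℂ, A = L * Lᴴ :=
  let ⟨L, h, _⟩ := exists_factor hA
  ⟨L, h.symm⟩

/-- With the factors of all `A i` side by side in M, M Mᴴ is the sum while Mᴴ M carries all their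
eigenvalues on its diagonal, so `vnEnt_le_sum_diag` suffices. -/
theorem vnEnt_sum_le {A : ι → Matrix n n ℂ} (hA : ∀ i, (A i).PosSemidef) :
    vnEnt (∑ i, A i) ≤ ∑ i, vnEnt (A i) := by
  classical
  choose L hL hL' using fun i => exists_factor (hA i)
  let M : Matrix n (ι × n) ℂ := of fun x p => L p.1 x p.2
  have hM : M * Mᴴ = ∑ i, A i := by
    ext x y
    simp only [mul_apply, Fintype.sum_prod_type, Matrix.sum_apply, ← hL]
    rfl
  have hM' : ∀ p, (Mᴴ * M) p p = ((hA p.1).1.eigenvalues p.2 : ℂ) := fun p => by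
    have := hL' p.1 p.2 p.2
    rw [if_pos rfl] at this
    rw [← this]; rfl
  rw [← hM, vnEnt_mul_conjTranspose_self]
  refine (vnEnt_le_sum_diag (posSemidef_conjTranspose_mul_self M)).trans_eq ?_
  simp only [hM', Complex.ofReal_re, Fintype.sum_prod_type, vnEnt, trace_cfc_re (hA _).1]

/-- Concavity of the entropy for unnormalised summands. In the eigenbasis of the sum, the diagonals
of the `A i` form an array with the traces as row sums and the eigenvalues as column sums; passing
to diagonals only raises the entropy of each `A i`. -/
theorem le_vnEnt_sum {A : ι → Matrix n n ℂ} (hA : ∀ i, (A i).PosSemidef) :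
    ∑ i, vnEnt (A i) + negMulLog (∑ i, (A i).trace.re) ≤
      vnEnt (∑ i, A i) + ∑ i, negMulLog (A i).trace.re := by
  have hS : (∑ i, A i).PosSemidef := posSemidef_sum _ fun i _ => hA i
  obtain ⟨U, h1, h2, hid, -⟩ := exists_diagonalization hS.1
  have hB : ∀ i, (Uᴴ * A i * U).PosSemidef := fun i => (hA i).conjTranspose_mul_mul_same U
  have htr : ∀ i, ∑ k, ((Uᴴ * A i * U) k k).re = (A i).trace.re := fun i => by
    rw [← trace_re, trace_mul_comm, ← mul_assoc, h2, one_mul]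
  have hev : ∀ k, ∑ i, ((Uᴴ * A i * U) k k).re = hS.1.eigenvalues k := fun k => by
    have : Uᴴ * (∑ i, A i) * U = diagonal fun i => (hS.1.eigenvalues i : ℂ) := by
      conv_lhs => rw [hid]
      rw [← mul_assoc, ← mul_assoc, h1, one_mul, mul_assoc, h1, mul_one]
    have := congrArg (fun M => (M k k).re) this
    simpa [Finset.mul_sum, Finset.sum_mul, Matrix.sum_apply] using this
  have key := sum_sum_negMulLog_add_le (fun i k => ((Uᴴ * A i * U) k k).re)
    fun i k => re_diag_nonneg (hB i) k
  simp only [htr, hev] at key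
  have h3 : ∑ i, vnEnt (A i) ≤ ∑ i, ∑ k, negMulLog ((Uᴴ * A i * U) k k).re :=
    Finset.sum_le_sum fun i _ => by
      rw [← vnEnt_unitary_conj (hA i).1 h2]; exact vnEnt_le_sum_diag (hB i)
  rw [vnEnt, trace_cfc_re hS.1]
  linarith

theorem negMulLog_trace_le_vnEnt {A : Matrix n n ℂ} (hA : A.PosSemidef) :
    negMulLog A.trace.re ≤ vnEnt A := by
  rw [vnEnt, trace_cfc_re hA.1, hA.1.trace_eq_sum_eigenvalues]
  simpa using negMulLog_sum_le _ hA.eigenvalues_nonneg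

theorem vnEnt_add_le {A B : Matrix n n ℂ} (hA : A.PosSemidef) (hB : B.PosSemidef) :
    vnEnt (A + B) ≤ vnEnt A + vnEnt B := by
  simpa using vnEnt_sum_le (A := ![A, B]) (by intro i; fin_cases i <;> assumption)

theorem le_vnEnt_add {A B : Matrix n n ℂ} (hA : A.PosSemidef) (hB : B.PosSemidef) :
    vnEnt A + vnEnt B - defect A.trace.re B.trace.re ≤ vnEnt (A + B) := by
  have := le_vnEnt_sum (A := ![A, B]) (by intro i; fin_cases i <;> assumption)
  simp only [Fin.sum_univ_two, cons_val_zero, cons_val_one] at this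
  unfold defect
  linarith


/-! ### Bipartite matrices and their blocks -/

section Bipartite

variable {s e m : Type*} [Fintype s] [DecidableEq s] [Fintype e] [DecidableEq e] [Fintype m]
  [DecidableEq m]

/-- The block `⟨i| A |j⟩` of a bipartite matrix. -/
def block {s e : Type*} (A : Matrix (s × e) (s × e) ℂ) (i j : s) : Matrix e e ℂ :=
  A.submatrix (Prod.mk i) (Prod.mk j)

/-- The bipartite matrix with blocks `Kᵢᴴ Kⱼ`. -/
def gram {s e m : Type*} [Fintype m] (K : s → Matrix m e ℂ) : Matrix (s × e) (s × e) ℂ :=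
  of fun p q => ((K p.1)ᴴ * K q.1) p.2 q.2

theorem block_gram {s e m : Type*} [Fintype m] (K : s → Matrix m e ℂ) (i j : s) :
    block (gram K) i j = (K i)ᴴ * K j := rfl

theorem gram_eq {s e m : Type*} [Fintype m] (K : s → Matrix m e ℂ) :
    gram K = (of fun x p => K p.1 x p.2 : Matrix m (s × e) ℂ)ᴴ *
      (of fun x p => K p.1 x p.2 : Matrix m (s × e) ℂ) := rfl

theorem gram_posSemidef (K : s → Matrix m e ℂ) : (gram K).PosSemidef := by
  rw [gram_eq]; exact posSemidef_conjTranspose_mul_self _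

theorem vnEnt_gram (K : s → Matrix m e ℂ) : vnEnt (gram K) = vnEnt (∑ i, K i * (K i)ᴴ) := by
  rw [gram_eq, ← vnEnt_mul_conjTranspose_self]
  congr 1
  ext x y
  simp only [mul_apply, Fintype.sum_prod_type, Matrix.sum_apply]
  rfl

theorem exists_gram {A : Matrix (s × e) (s × e) ℂ} (hA : A.PosSemidef) :
    ∃ K : s → Matrix (s × e) e ℂ, A = gram K := by
  obtain ⟨L, hL⟩ := exists_eq_mul_conjTranspose hA
  refine ⟨fun i => of fun x y => Lᴴ x (i, y), ?_⟩
  rw [hL]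
  ext p q
  simp [gram, mul_apply]

theorem block_posSemidef {s e : Type*} {A : Matrix (s × e) (s × e) ℂ} (hA : A.PosSemidef) (i : s) :
    (block A i i).PosSemidef := hA.submatrix _

theorem sum_trace_block {s e : Type*} [Fintype s] [Fintype e] (A : Matrix (s × e) (s × e) ℂ) :
    ∑ i, (block A i i).trace = A.trace := by
  simp [trace, block, Fintype.sum_prod_type]

theorem sum_trace_block_re {s e : Type*} [Fintype s] [Fintype e] (A : Matrix (s × e) (s × e) ℂ) :
    ∑ i, (block A i i).trace.re = A.trace.re := by
  rw [← sum_trace_block, Complex.re_sum]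

theorem traceLeft_eq_sum_block {s e : Type*} [Fintype s] (A : Matrix (s × e) (s × e) ℂ) :
    traceLeft A = ∑ i, block A i i := by
  ext x y; simp [traceLeft, block, Matrix.sum_apply]

theorem traceLeft_posSemidef {A : Matrix (s × e) (s × e) ℂ} (hA : A.PosSemidef) :
    (traceLeft A).PosSemidef := by
  rw [traceLeft_eq_sum_block]; exact posSemidef_sum _ fun i _ => block_posSemidef hA i

theorem trace_traceLeft {s e : Type*} [Fintype s] [Fintype e] (A : Matrix (s × e) (s × e) ℂ) :
    (traceLeft A).trace = A.trace := by
  rw [traceLeft_eq_sum_block, trace_sum, sum_trace_block]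

theorem traceLeft_add {s e : Type*} [Fintype s] (A B : Matrix (s × e) (s × e) ℂ) :
    traceLeft (A + B) = traceLeft A + traceLeft B := by
  ext; simp [traceLeft, Finset.sum_add_distrib]

theorem traceRight_apply_self {s e : Type*} [Fintype e] (A : Matrix (s × e) (s × e) ℂ) (i : s) :
    traceRight A i i = (block A i i).trace := by
  simp [traceRight, block, trace]

theorem trace_traceRight {s e : Type*} [Fintype s] [Fintype e] (A : Matrix (s × e) (s × e) ℂ) :
    (traceRight A).trace = A.trace := by
  rw [← sum_trace_block]
  exact Finset.sum_congr rfl fun i _ => traceRight_apply_self A i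

theorem traceRight_add {s e : Type*} [Fintype e] (A B : Matrix (s × e) (s × e) ℂ) :
    traceRight (A + B) = traceRight A + traceRight B := by
  ext; simp [traceRight, Finset.sum_add_distrib]

theorem traceRight_posSemidef {A : Matrix (s × e) (s × e) ℂ} (hA : A.PosSemidef) :
    (traceRight A).PosSemidef := by
  have : traceRight A = ∑ x, A.submatrix (fun i => (i, x)) (fun i => (i, x)) := by
    ext; simp [traceRight, Matrix.sum_apply]
  rw [this]
  exact posSemidef_sum _ fun x _ => hA.submatrix _

/-- In Gram form A has the entropy of Σ K_i K_iᴴ and its i-th diagonal block that of K_i K_iᴴ, so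
this is subadditivity. -/
theorem vnEnt_le_sum_vnEnt_block {A : Matrix (s × e) (s × e) ℂ} (hA : A.PosSemidef) :
    vnEnt A ≤ ∑ i, vnEnt (block A i i) := by
  obtain ⟨K, rfl⟩ := exists_gram hA
  rw [vnEnt_gram]
  simp only [block_gram, ← vnEnt_mul_conjTranspose_self]
  exact vnEnt_sum_le fun i => posSemidef_self_mul_conjTranspose _

/-- Concavity in the same Gram picture; the logarithm bounds the entropy of the block weights. -/
theorem sum_vnEnt_block_le {A : Matrix (s × e) (s × e) ℂ} (hA : A.PosSemidef) :
    ∑ i, vnEnt (block A i i) ≤ vnEnt A + A.trace.re * log (Fintype.card s) := by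
  have h2 := sum_negMulLog_le (fun i => (block A i i).trace.re)
    fun i => re_trace_nonneg (block_posSemidef hA i)
  rw [sum_trace_block_re] at h2
  obtain ⟨K, rfl⟩ := exists_gram hA
  have h1 := le_vnEnt_sum fun i => posSemidef_self_mul_conjTranspose (K i)
  simp only [trace_mul_comm (K _), vnEnt_mul_conjTranspose_self, ← block_gram,
    sum_trace_block_re] at h1
  rw [vnEnt_gram]
  linarith

/-- Assembling the factors of the blocks into a block diagonal W makes Wᴴ W diagonal, listing the
eigenvalues of every block. -/
theorem vnEnt_eq_sum_vnEnt_block {A : Matrix (s × e) (s × e) ℂ}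
    (hA : ∀ i, (block A i i).PosSemidef) (hoff : ∀ i j, i ≠ j → block A i j = 0) :
    vnEnt A = ∑ i, vnEnt (block A i i) := by
  choose L hL hL' using fun i => exists_factor (hA i)
  let W : Matrix (s × e) (s × e) ℂ := of fun p q => if p.1 = q.1 then L p.1 p.2 q.2 else 0
  have h1 : W * Wᴴ = A := by
    ext ⟨i, x⟩ ⟨j, y⟩
    have hij : (W * Wᴴ) (i, x) (j, y) = if i = j then (L i * (L i)ᴴ) x y else 0 := by
      simp only [W, mul_apply, Fintype.sum_prod_type, conjTranspose_apply, of_apply]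
      rw [Finset.sum_eq_single i]
      · rcases eq_or_ne i j with rfl | h
        · simp
        · simp [h, h.symm]
      · intro k _ hk; simp [hk.symm]
      · simp
    rw [hij]
    split_ifs with h
    · subst h; rw [hL]; rfl
    · exact (congrFun (congrFun (hoff i j h) x) y).symm
  have h2 : Wᴴ * W = diagonal fun p => (((hA p.1).1.eigenvalues p.2 : ℝ) : ℂ) := by
    ext ⟨i, x⟩ ⟨j, y⟩
    simp only [W, mul_apply, Fintype.sum_prod_type, conjTranspose_apply, of_apply]
    rw [Finset.sum_eq_single i]
    · rcases eq_or_ne i j with rfl | h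
      · have := hL' i x y
        simp only [mul_apply, conjTranspose_apply] at this
        simpa [diagonal_apply] using this
      · simp [h]
    · intro k _ hk; simp [hk]
    · simp
  have h3 : vnEnt A = ∑ p : s × e, negMulLog ((hA p.1).1.eigenvalues p.2) := by
    rw [← vnEnt_diagonal, ← h2, ← vnEnt_mul_conjTranspose_self, h1]
  rw [h3, Fintype.sum_prod_type]
  simp only [vnEnt, trace_cfc_re (hA _).1]

theorem vnEnt_sum_eq_of_orthogonal (K : s → Matrix m e ℂ)
    (hK : ∀ i j, i ≠ j → (K i)ᴴ * K j = 0) :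
    vnEnt (∑ i, K i * (K i)ᴴ) = ∑ i, vnEnt (K i * (K i)ᴴ) := by
  rw [← vnEnt_gram, vnEnt_eq_sum_vnEnt_block (fun i => block_posSemidef (gram_posSemidef K) i) hK]
  simp only [block_gram, vnEnt_mul_conjTranspose_self]

/-! ### Two almost additive functionals -/

/-- The entropy gained by discarding the off-diagonal blocks of a bipartite matrix. -/
def coherence (A : Matrix (s × e) (s × e) ℂ) : ℝ := ∑ i, vnEnt (block A i i) - vnEnt A

/-- The mutual information minus the entropy of the diagonal of the first marginal (in nats). -/
def broadcastGap (A : Matrix (s × e) (s × e) ℂ) : ℝ :=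
  vnEnt (traceRight A) - ∑ i, negMulLog (traceRight A i i).re + vnEnt (traceLeft A) - vnEnt A

theorem coherence_nonneg {A : Matrix (s × e) (s × e) ℂ} (hA : A.PosSemidef) :
    0 ≤ coherence A := sub_nonneg.2 (vnEnt_le_sum_vnEnt_block hA)

theorem coherence_le {A : Matrix (s × e) (s × e) ℂ} (hA : A.PosSemidef) :
    coherence A ≤ log (Fintype.card s) * A.trace.re := by
  have := sum_vnEnt_block_le hA
  unfold coherence; linarith

theorem block_add {s e : Type*} (A B : Matrix (s × e) (s × e) ℂ) (i j : s) :
    block (A + B) i j = block A i j + block B i j := rfl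

/-- The additivity error of the block sum lies in [-δ, 0] and that of -S(A) in [0, δ], so the errors
do not accumulate beyond δ. -/
theorem abs_coherence_add_sub_le {A B : Matrix (s × e) (s × e) ℂ} (hA : A.PosSemidef)
    (hB : B.PosSemidef) :
    |coherence (A + B) - coherence A - coherence B| ≤ 1 * defect A.trace.re B.trace.re := by
  have h1 := Finset.sum_le_sum fun i (_ : i ∈ Finset.univ) =>
    vnEnt_add_le (block_posSemidef hA i) (block_posSemidef hB i)
  have h2 := Finset.sum_le_sum fun i (_ : i ∈ Finset.univ) =>
    le_vnEnt_add (block_posSemidef hA i) (block_posSemidef hB i)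
  have h3 := sum_defect_le (fun i => (block A i i).trace.re) (fun i => (block B i i).trace.re)
    (fun i => re_trace_nonneg (block_posSemidef hA i))
    (fun i => re_trace_nonneg (block_posSemidef hB i))
  have h4 := vnEnt_add_le hA hB
  have h5 := le_vnEnt_add hA hB
  simp only [sum_trace_block_re] at h3
  simp only [Finset.sum_add_distrib, Finset.sum_sub_distrib] at h1 h2
  simp only [coherence, block_add]
  rw [abs_le]
  constructor <;> linarith

/-- S(A_S) is at most the entropy of its diagonal, and S(A_E) at most the sum of the block
entropies, which exceeds S(A) by at most tr A · log d. -/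
theorem broadcastGap_le {A : Matrix (s × e) (s × e) ℂ} (hA : A.PosSemidef) :
    broadcastGap A ≤ log (Fintype.card s) * A.trace.re := by
  have h1 := vnEnt_le_sum_diag (traceRight_posSemidef hA)
  have h2 := vnEnt_sum_le fun i => block_posSemidef hA i
  rw [← traceLeft_eq_sum_block] at h2
  have h3 := sum_vnEnt_block_le hA
  unfold broadcastGap; linarith

/-- One log d is lost from the entropy of the diagonal of A_S, the other from concavity in S(A_E)
against the block entropies. -/
theorem le_broadcastGap {A : Matrix (s × e) (s × e) ℂ} (hA : A.PosSemidef) :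
    -(2 * log (Fintype.card s)) * A.trace.re ≤ broadcastGap A := by
  have h1 := negMulLog_trace_le_vnEnt (traceRight_posSemidef hA)
  have h2 := sum_negMulLog_le (fun i => (traceRight A i i).re)
    (fun i => re_diag_nonneg (traceRight_posSemidef hA) i)
  rw [← trace_re, trace_traceRight] at h2
  rw [trace_traceRight] at h1
  have h3 := le_vnEnt_sum fun i => block_posSemidef hA i
  rw [← traceLeft_eq_sum_block, sum_trace_block_re] at h3
  have h4 := vnEnt_le_sum_vnEnt_block hA
  have h5 := sum_negMulLog_le (fun i => (block A i i).trace.re)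
    fun i => re_trace_nonneg (block_posSemidef hA i)
  rw [sum_trace_block_re] at h5
  unfold broadcastGap; linarith

/-- Of the four entropies two enter with each sign, and each is additive up to an error in [-δ, 0];
hence the constant 2. -/
theorem abs_broadcastGap_add_sub_le {A B : Matrix (s × e) (s × e) ℂ} (hA : A.PosSemidef)
    (hB : B.PosSemidef) :
    |broadcastGap (A + B) - broadcastGap A - broadcastGap B| ≤
      2 * defect A.trace.re B.trace.re := by
  have h1 := vnEnt_add_le (traceRight_posSemidef hA) (traceRight_posSemidef hB)
  have h2 := le_vnEnt_add (traceRight_posSemidef hA) (traceRight_posSemidef hB)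
  have h3 := vnEnt_add_le (traceLeft_posSemidef hA) (traceLeft_posSemidef hB)
  have h4 := le_vnEnt_add (traceLeft_posSemidef hA) (traceLeft_posSemidef hB)
  have h5 := vnEnt_add_le hA hB
  have h6 := le_vnEnt_add hA hB
  have hd := fun i => re_diag_nonneg (traceRight_posSemidef hA) i
  have hd' := fun i => re_diag_nonneg (traceRight_posSemidef hB) i
  have h7 := sum_defect_le _ _ hd hd'
  have h8 := Finset.sum_nonneg fun i (_ : i ∈ Finset.univ) => defect_nonneg (hd i) (hd' i)
  simp only [defect, Finset.sum_add_distrib, Finset.sum_sub_distrib] at h8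
  rw [← trace_re, ← trace_re] at h7
  simp only [trace_traceRight, trace_traceLeft] at h2 h4 h7
  conv at h7 => lhs; simp only [defect, Finset.sum_add_distrib, Finset.sum_sub_distrib]
  simp only [broadcastGap, traceRight_add, traceLeft_add, Matrix.add_apply, Complex.add_re] at *
  rw [abs_le]
  constructor <;> linarith

end Bipartite

/-! ### Continuity of almost additive functionals -/

section Continuity

variable {n ι : Type*} [Fintype n] [DecidableEq n] [Fintype ι]

/-- Polarisation: as H is Hermitian, it is the sum of (L+R)(L+R)ᴴ/4 - (L-R)(L-R)ᴴ/4. The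
parallelogram law gives the traces. -/
theorem exists_posSemidef_decomposition {p : ι → Type*} [∀ a, Fintype (p a)]
    {H : Matrix n n ℂ} (hH : H.IsHermitian)
    (L R : ∀ a, Matrix n (p a) ℂ) (h : H = ∑ a, L a * (R a)ᴴ) :
    ∃ X Y : Matrix n n ℂ, X.PosSemidef ∧ Y.PosSemidef ∧ H + X = Y ∧
      X.trace.re + Y.trace.re =
        1 / 2 * ∑ a, ((L a * (L a)ᴴ).trace.re + (R a * (R a)ᴴ).trace.re) := by
  have h4 : (0 : ℂ) ≤ 1 / 4 := by
    rw [Complex.le_def]; norm_num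
  refine ⟨(1 / 4 : ℂ) • ∑ a, (L a - R a) * (L a - R a)ᴴ,
    (1 / 4 : ℂ) • ∑ a, (L a + R a) * (L a + R a)ᴴ,
    (posSemidef_sum _ fun a _ => posSemidef_self_mul_conjTranspose _).smul h4,
    (posSemidef_sum _ fun a _ => posSemidef_self_mul_conjTranspose _).smul h4, ?_, ?_⟩
  · have h' : H = ∑ a, R a * (L a)ᴴ := by
      conv_lhs => rw [← hH.eq, h]
      simp [conjTranspose_sum, conjTranspose_mul]
    have h2 : H = (1 / 2 : ℂ) • (∑ a, L a * (R a)ᴴ + ∑ a, R a * (L a)ᴴ) := by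
      rw [← h, ← h', ← two_smul ℂ H, smul_smul]; norm_num
    conv_lhs => rw [h2]
    simp only [Finset.smul_sum, ← Finset.sum_add_distrib, conjTranspose_add, conjTranspose_sub]
    refine Finset.sum_congr rfl fun a _ => ?_
    simp only [Matrix.mul_add, Matrix.mul_sub, Matrix.add_mul, Matrix.sub_mul]
    module
  · rw [← Complex.add_re, ← trace_add, ← smul_add, ← Finset.sum_add_distrib]
    have : ∀ a, (L a - R a) * (L a - R a)ᴴ + (L a + R a) * (L a + R a)ᴴ =
        (2 : ℂ) • (L a * (L a)ᴴ + R a * (R a)ᴴ) := fun a => by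
      simp only [conjTranspose_add, conjTranspose_sub, Matrix.mul_add, Matrix.mul_sub, Matrix.add_mul,
        Matrix.sub_mul]
      module
    simp only [this, ← Finset.smul_sum, smul_smul, trace_smul, trace_sum, trace_add,
      smul_eq_mul]
    rw [show (1 / 4 * 2 : ℂ) = ((1 / 2 : ℝ) : ℂ) by norm_num, Complex.re_ofReal_mul,
      Complex.re_sum]
    simp

/-- Φ is evaluated on ρ + X = τ + Y in both ways: two additivity errors give 2cδ(1,x), and Φ(Y) -
Φ(X) costs at most (α + β) tr X. Equal traces of X and Y turn the bound 4x into tr X ≤ x. -/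
theorem abs_sub_le_of_almost_additive {Φ : Matrix n n ℂ → ℝ} {c α β : ℝ} (hc : 0 ≤ c)
    (hαβ : 0 ≤ α + β)
    (hadd : ∀ {A B}, A.PosSemidef → B.PosSemidef →
      |Φ (A + B) - Φ A - Φ B| ≤ c * defect A.trace.re B.trace.re)
    (hlo : ∀ {A}, A.PosSemidef → -α * A.trace.re ≤ Φ A)
    (hhi : ∀ {A}, A.PosSemidef → Φ A ≤ β * A.trace.re)
    {ρ τ : Matrix n n ℂ} (hρ : IsState ρ) (hτ : IsState τ)
    {p : ι → Type*} [∀ a, Fintype (p a)] (L R : ∀ a, Matrix n (p a) ℂ)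
    (h : ρ - τ = ∑ a, L a * (R a)ᴴ) {x : ℝ}
    (hx : ∑ a, ((L a * (L a)ᴴ).trace.re + (R a * (R a)ᴴ).trace.re) ≤ 4 * x) :
    |Φ ρ - Φ τ| ≤ 2 * c * defect 1 x + (α + β) * x := by
  obtain ⟨X, Y, hX, hY, hXY, ht⟩ :=
    exists_posSemidef_decomposition (hρ.1.1.sub hτ.1.1) L R h
  have hXY' : ρ + X = τ + Y := by rw [← hXY]; abel
  have hρt : ρ.trace.re = 1 := by rw [hρ.2]; rfl
  have hτt : τ.trace.re = 1 := by rw [hτ.2]; rfl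
  have htt : X.trace.re = Y.trace.re := by
    have := congrArg (fun M => (trace M).re) hXY'
    simp only [trace_add, Complex.add_re, hρt, hτt] at this
    linarith
  have hX0 := re_trace_nonneg hX
  have hXx : X.trace.re ≤ x := by linarith
  have h1 := hadd hρ.1 hX
  have h2 := hadd hτ.1 hY
  rw [hXY', hρt] at h1
  rw [hτt, ← htt] at h2
  have hd := mul_le_mul_of_nonneg_left (defect_mono_right zero_le_one hX0 hXx) hc
  have h3 := hlo hX
  have h4 := hlo hY
  have h5 := hhi hX
  have h6 := hhi hY
  have h7 := mul_le_mul_of_nonneg_left hXx hαβ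
  rw [← htt] at h4 h6
  rw [abs_le] at *
  constructor <;> linarith

/-- A balanced singular value decomposition: each factor receives the square root of every singular
value. -/
theorem exists_traceNorm_factorization (C : Matrix n n ℂ) :
    ∃ L R : Matrix n n ℂ, C = L * Rᴴ ∧ (L * Lᴴ).trace.re = traceNorm C ∧
      (R * Rᴴ).trace.re = traceNorm C := by
  have hH := posSemidef_conjTranspose_mul_self C
  obtain ⟨U, h1, h2, hid, -⟩ := exists_diagonalization hH.1
  set l := hH.1.eigenvalues with hl
  have hl0 : ∀ i, 0 ≤ l i := hH.eigenvalues_nonneg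
  have hD : (C * U)ᴴ * (C * U) = diagonal fun i => (l i : ℂ) := by
    rw [conjTranspose_mul, mul_assoc, ← mul_assoc Cᴴ]
    conv_lhs => rw [hid]
    rw [mul_assoc, mul_assoc, h1, mul_one, ← mul_assoc, h1, one_mul]
  have hcol : ∀ j, l j = 0 → ∀ i, (C * U) i j = 0 := by
    intro j hj i
    have := congrArg (fun M => (M j j).re) hD
    simp only [mul_apply (M := (C * U)ᴴ), conjTranspose_apply, diagonal_apply_eq, hj, Complex.re_sum,
      Complex.ofReal_zero, Complex.zero_re] at this
    have hn : ∀ k, (star ((C * U) k j) * (C * U) k j).re = ‖(C * U) k j‖ ^ 2 := fun k => by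
      rw [← starRingEnd_apply, mul_comm, Complex.mul_conj, Complex.normSq_eq_norm_sq,
        Complex.ofReal_re]
    simp only [hn] at this
    rw [Finset.sum_eq_zero_iff_of_nonneg fun k _ => sq_nonneg _] at this
    simpa using this i (Finset.mem_univ i)
  have hreal : ∀ d : n → ℝ, (diagonal fun i => (d i : ℂ))ᴴ = diagonal fun i => (d i : ℂ) := by
    intro d; rw [diagonal_conjTranspose]; congr 1; ext i; simp
  have ht : traceNorm C = ∑ i, √(l i) := trace_cfc_re hH.1 _
  -- The l i are squared singular values, hence the fourth roots. Where l i = 0 the inverse is read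
  -- as 0, harmless since that column of C U vanishes.
  refine ⟨C * U * diagonal (fun i => (((√(√(l i)))⁻¹ : ℝ) : ℂ)), 
    U * diagonal (fun i => ((√(√(l i)) : ℝ) : ℂ)),    ?_, ?_, ?_⟩
  · rw [conjTranspose_mul, hreal, mul_assoc, ← mul_assoc _ _ Uᴴ, diagonal_mul_diagonal, ← mul_assoc]
    have : C * U * diagonal (fun i => (((√(√(l i)))⁻¹ : ℝ) : ℂ) * (√(√(l i)) : ℝ)) = C * U := by
      ext i j
      rw [mul_diagonal]
      by_cases hj : l j = 0
      · rw [hcol j hj i, zero_mul]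
      · have h0 : √(√(l j)) ≠ 0 := by
          have := (hl0 j).lt_of_ne' hj
          positivity
        rw [← Complex.ofReal_mul, inv_mul_cancel₀ h0, Complex.ofReal_one, mul_one]
    rw [this, mul_assoc, h2, mul_one]
  · rw [trace_mul_comm, conjTranspose_mul, hreal, mul_assoc, ← mul_assoc _ (C * U), hD,
      diagonal_mul_diagonal, diagonal_mul_diagonal, trace_diagonal, ht, Complex.re_sum]
    refine Finset.sum_congr rfl fun i _ => ?_
    rw [← Complex.ofReal_mul, ← Complex.ofReal_mul, Complex.ofReal_re]
    rcases (hl0 i).eq_or_lt with h | h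
    · simp [← h]
    · have h0 : √(√(l i)) ≠ 0 := by positivity
      field_simp
      rw [Real.sq_sqrt (Real.sqrt_nonneg _), Real.mul_self_sqrt h.le]
  · rw [trace_mul_comm, conjTranspose_mul, hreal, mul_assoc, ← mul_assoc _ U, h1, one_mul,
      diagonal_mul_diagonal, trace_diagonal, ht, Complex.re_sum]
    refine Finset.sum_congr rfl fun i _ => ?_
    rw [← Complex.ofReal_mul, Complex.ofReal_re, Real.mul_self_sqrt (Real.sqrt_nonneg _)]

theorem traceNorm_nonneg (C : Matrix n n ℂ) : 0 ≤ traceNorm C := by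
  obtain ⟨L, -, -, h, -⟩ := exists_traceNorm_factorization C
  rw [← h]; exact re_trace_nonneg (posSemidef_self_mul_conjTranspose L)

open scoped Matrix.Norms.L2Operator in
theorem continuous_traceNorm : Continuous fun A : Matrix n n ℂ => traceNorm A := by
  have h : Continuous fun A : Matrix n n ℂ => cfc Real.sqrt (Aᴴ * A) :=
    Continuous.cfc_of_mem_nhdsSet (s := Set.univ) Real.sqrt (by simp) (by fun_prop)
      (fun A => IsSelfAdjoint.star_mul_self A) Real.continuous_sqrt.continuousOn
  exact Complex.continuous_re.comp h.matrix_trace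

end Continuity

/-! ### Continuity bounds for the two bipartite functionals. -/

section Bipartite

variable {s e ι : Type*} [Fintype s] [DecidableEq s] [Fintype e] [DecidableEq e] [Fintype ι]

theorem abs_broadcastGap_sub_le {ρ τ : Matrix (s × e) (s × e) ℂ} (hρ : IsState ρ)
    (hτ : IsState τ) {p : ι → Type*} [∀ a, Fintype (p a)] (L R : ∀ a, Matrix (s × e) (p a) ℂ)
    (h : ρ - τ = ∑ a, L a * (R a)ᴴ) {x : ℝ}
    (hx : ∑ a, ((L a * (L a)ᴴ).trace.re + (R a * (R a)ᴴ).trace.re) ≤ 4 * x) :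
    |broadcastGap ρ - broadcastGap τ| ≤ 4 * defect 1 x + 3 * log (Fintype.card s) * x := by
  have := abs_sub_le_of_almost_additive zero_le_two
    (by have := Real.log_natCast_nonneg (Fintype.card s); linarith) abs_broadcastGap_add_sub_le
    le_broadcastGap broadcastGap_le hρ hτ L R h hx
  linarith

theorem abs_coherence_sub_le {ρ τ : Matrix (s × e) (s × e) ℂ} (hρ : IsState ρ)
    (hτ : IsState τ) {p : ι → Type*} [∀ a, Fintype (p a)] (L R : ∀ a, Matrix (s × e) (p a) ℂ)
    (h : ρ - τ = ∑ a, L a * (R a)ᴴ) {x : ℝ}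
    (hx : ∑ a, ((L a * (L a)ᴴ).trace.re + (R a * (R a)ᴴ).trace.re) ≤ 4 * x) :
    |coherence ρ - coherence τ| ≤ 2 * defect 1 x + log (Fintype.card s) * x := by
  have := abs_sub_le_of_almost_additive zero_le_one (α := 0)
    (by have := Real.log_natCast_nonneg (Fintype.card s); linarith) abs_coherence_add_sub_le
    (fun hA => by simpa using coherence_nonneg hA) coherence_le hρ hτ L R h hx
  linarith

end Bipartite


/-! ### Tensor products -/

section Tensor

variable {K : Type*} [Fintype K] [DecidableEq K] {n : K → Type*} [∀ k, Fintype (n k)]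
  [∀ k, DecidableEq (n k)]

theorem tensor_mul (A B : ∀ k, Matrix (n k) (n k) ℂ) :
    tensor A * tensor B = tensor fun k => A k * B k := by
  ext x y
  simp only [tensor, mul_apply, of_apply, ← Finset.prod_mul_distrib]
  rw [Finset.prod_univ_sum, Fintype.piFinset_univ]

theorem conjTranspose_tensor (A : ∀ k, Matrix (n k) (n k) ℂ) :
    (tensor A)ᴴ = tensor fun k => (A k)ᴴ := by
  ext x y
  simp [tensor]

theorem trace_tensor (A : ∀ k, Matrix (n k) (n k) ℂ) : (tensor A).trace = ∏ k, (A k).trace := by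
  simp only [trace, diag_apply, tensor, of_apply]
  rw [Finset.prod_univ_sum, Fintype.piFinset_univ]

theorem tensor_smul (c : K → ℂ) (A : ∀ k, Matrix (n k) (n k) ℂ) :
    tensor (fun k => c k • A k) = (∏ k, c k) • tensor A := by
  ext x y
  simp [tensor, Finset.prod_mul_distrib]

theorem tensor_eq_zero (A : ∀ k, Matrix (n k) (n k) ℂ) (k : K) (h : A k = 0) : tensor A = 0 := by
  ext x y
  exact Finset.prod_eq_zero (Finset.mem_univ k) (by simp [h])

theorem tensor_posSemidef {A : ∀ k, Matrix (n k) (n k) ℂ} (hA : ∀ k, (A k).PosSemidef) :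
    (tensor A).PosSemidef := by
  choose L hL using fun k => exists_eq_mul_conjTranspose (hA k)
  have : tensor A = tensor L * (tensor L)ᴴ := by
    rw [conjTranspose_tensor, tensor_mul]; exact congrArg _ (funext hL)
  rw [this]; exact posSemidef_self_mul_conjTranspose _

end Tensor

/-! ### Matrix square roots and fidelity. -/

section Sqrt

variable {n : Type*} [Fintype n] [DecidableEq n]

theorem conjTranspose_cfc_sqrt {A : Matrix n n ℂ} (hA : A.PosSemidef) :
    (cfc Real.sqrt A)ᴴ = cfc Real.sqrt A := by
  obtain ⟨U, h1, h2, hid, h⟩ := exists_diagonalization hA.1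
  rw [h]
  simp only [conjTranspose_mul, diagonal_conjTranspose, conjTranspose_conjTranspose, mul_assoc]
  congr 3; ext i; simp

theorem cfc_sqrt_mul_self {A : Matrix n n ℂ} (hA : A.PosSemidef) :
    cfc Real.sqrt A * cfc Real.sqrt A = A := by
  obtain ⟨U, h1, h2, hid, h⟩ := exists_diagonalization hA.1
  conv_rhs => rw [hid]
  rw [h, mul_assoc, ← mul_assoc Uᴴ, ← mul_assoc Uᴴ, h1, one_mul, ← mul_assoc, mul_assoc U,
    diagonal_mul_diagonal]
  congr 3; ext i
  rw [← Complex.ofReal_mul, Real.mul_self_sqrt (hA.eigenvalues_nonneg i)]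

theorem fidelity_nonneg (ρ σ : Matrix n n ℂ) : 0 ≤ fidelity ρ σ := traceNorm_nonneg _

theorem ofReal_trace_re {A : Matrix n n ℂ} (hA : A.IsHermitian) : (A.trace.re : ℂ) = A.trace :=
  Complex.conj_eq_iff_re.1 (by
    rw [starRingEnd_apply, ← trace_conjTranspose, hA.eq])

end Sqrt

/-! ### Block matrices as sums of products -/

section Embed

variable {s e p : Type*} [Fintype s] [DecidableEq s] [Fintype e] [DecidableEq e] [Fintype p]

/-- The block column with the single nonzero block `L` in position `i`. -/
def embed {s e p : Type*} [DecidableEq s] (i : s) (L : Matrix e p ℂ) : Matrix (s × e) p ℂ :=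
  of fun q y => if q.1 = i then L q.2 y else 0

theorem embed_mul_conjTranspose_apply (i j : s) (L R : Matrix e p ℂ) (q r : s × e) :
    (embed i L * (embed j R)ᴴ) q r = if q.1 = i ∧ r.1 = j then (L * Rᴴ) q.2 r.2 else 0 := by
  by_cases h1 : q.1 = i <;> by_cases h2 : r.1 = j <;> simp [embed, mul_apply, h1, h2]

theorem trace_embed (i : s) (L : Matrix e p ℂ) :
    (embed i L * (embed i L)ᴴ).trace = (L * Lᴴ).trace := by
  simp only [trace, diag_apply, embed_mul_conjTranspose_apply, Fintype.sum_prod_type, and_self]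
  rw [Finset.sum_eq_single i] <;> simp +contextual

theorem eq_sum_embed (M : Matrix (s × e) (s × e) ℂ) (L R : s → s → Matrix e p ℂ)
    (h : ∀ i j, block M i j = L i j * (R i j)ᴴ) :
    M = ∑ a : s × s, embed a.1 (L a.1 a.2) * (embed a.2 (R a.1 a.2))ᴴ := by
  ext q r
  rw [Matrix.sum_apply, Finset.sum_eq_single (q.1, r.1)]
  · rw [embed_mul_conjTranspose_apply, if_pos ⟨rfl, rfl⟩, ← h]; rfl
  · intro a _ ha
    rw [embed_mul_conjTranspose_apply, if_neg]
    rintro ⟨h1, h2⟩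
    exact ha (Prod.ext h1.symm h2.symm)
  · simp

/-- Factoring block by block replaces a trace norm estimate of M by separate estimates of its
off-diagonal blocks; the 2 counts L and R. -/
theorem exists_embed_decomposition (M : Matrix (s × e) (s × e) ℂ) (w : s → s → ℝ)
    (hdiag : ∀ i, block M i i = 0)
    (hoff : ∀ i j, i ≠ j → ∃ L R : Matrix e e ℂ, block M i j = L * Rᴴ ∧
      (L * Lᴴ).trace.re ≤ w i j ∧ (R * Rᴴ).trace.re ≤ w i j) :
    ∃ L R : s × s → Matrix (s × e) e ℂ, M = ∑ a, L a * (R a)ᴴ ∧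
      ∑ a, ((L a * (L a)ᴴ).trace.re + (R a * (R a)ᴴ).trace.re) ≤
        2 * ∑ i, ∑ j, if i = j then 0 else w i j := by
  have : ∀ i j, ∃ L R : Matrix e e ℂ, block M i j = L * Rᴴ ∧
      (L * Lᴴ).trace.re ≤ (if i = j then 0 else w i j) ∧
      (R * Rᴴ).trace.re ≤ (if i = j then 0 else w i j) := by
    intro i j
    split_ifs with h
    · subst h; exact ⟨0, 0, by simp [hdiag]⟩
    · exact hoff i j h
  choose L R h hL hR using this
  refine ⟨_, _, eq_sum_embed M L R h, ?_⟩
  simp only [trace_embed, Fintype.sum_prod_type, Finset.mul_sum]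
  exact Finset.sum_le_sum fun i _ => Finset.sum_le_sum fun j _ => by linarith [hL i j, hR i j]

/-- The block diagonal part of a bipartite matrix. -/
def dephase {s e : Type*} [DecidableEq s] (A : Matrix (s × e) (s × e) ℂ) :
    Matrix (s × e) (s × e) ℂ :=
  of fun p q => if p.1 = q.1 then A p q else 0

theorem block_dephase (A : Matrix (s × e) (s × e) ℂ) (i j : s) :
    block (dephase A) i j = if i = j then block A i j else 0 := by
  ext x y
  by_cases h : i = j <;> simp [dephase, block, h]

theorem posSemidef_of_block {A : Matrix (s × e) (s × e) ℂ} (hA : ∀ i, (block A i i).PosSemidef)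
    (hoff : ∀ i j, i ≠ j → block A i j = 0) : A.PosSemidef := by
  choose L hL using fun i => exists_eq_mul_conjTranspose (hA i)
  have : A = ∑ a : s × s, embed a.1 (if a.1 = a.2 then L a.1 else 0) *
      (embed a.2 (if a.1 = a.2 then L a.1 else 0))ᴴ := by
    refine eq_sum_embed A (fun i j => if i = j then L i else 0)
      (fun i j => if i = j then L i else 0) fun i j => ?_
    split_ifs with h
    · subst h; exact hL i
    · simp [hoff i j h]
  rw [this]
  refine posSemidef_sum _ fun a _ => ?_
  by_cases h : a.1 = a.2
  · rw [h]; exact posSemidef_self_mul_conjTranspose _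
  · simp only [if_neg h]
    have : (embed a.1 (0 : Matrix e e ℂ)) = 0 := by ext; simp [embed]
    rw [this, Matrix.zero_mul]
    exact PosSemidef.zero

theorem isState_of_block {A : Matrix (s × e) (s × e) ℂ} (hA : ∀ i, (block A i i).PosSemidef)
    (hoff : ∀ i j, i ≠ j → block A i j = 0) (ht : ∑ i, (block A i i).trace = 1) : IsState A :=
  ⟨posSemidef_of_block hA hoff, by rw [← sum_trace_block, ht]⟩

theorem coherence_eq_zero {A : Matrix (s × e) (s × e) ℂ} (hA : ∀ i, (block A i i).PosSemidef)
    (hoff : ∀ i j, i ≠ j → block A i j = 0) : coherence A = 0 := by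
  rw [coherence, ← vnEnt_eq_sum_vnEnt_block hA hoff, sub_self]

theorem broadcastGap_of_block_eq_zero {A : Matrix (s × e) (s × e) ℂ}
    (hA : ∀ i, (block A i i).PosSemidef) (hoff : ∀ i j, i ≠ j → block A i j = 0) :
    broadcastGap A = vnEnt (∑ i, block A i i) - ∑ i, vnEnt (block A i i) := by
  have h : traceRight A = diagonal fun i => ((block A i i).trace.re : ℂ) := by
    ext i j
    by_cases hij : i = j
    · subst hij
      rw [traceRight_apply_self, diagonal_apply_eq]
      exact (ofReal_trace_re (hA i).1).symm
    · rw [diagonal_apply_ne _ hij]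
      exact Finset.sum_eq_zero fun x _ => congrFun (congrFun (hoff i j hij) x) x
  rw [broadcastGap, traceLeft_eq_sum_block, vnEnt_eq_sum_vnEnt_block hA hoff]
  conv_lhs => rw [h, vnEnt_diagonal]
  simp

/-- The dephased state of a bipartite state whose diagonal blocks are `Kᵢ Kᵢᴴ` has as gap the
coherence of the Gram matrix of the `Kᵢ`. -/
theorem broadcastGap_dephase {A : Matrix (s × e) (s × e) ℂ} (K : s → Matrix e e ℂ)
    (h1 : ∀ i, block A i i = K i * (K i)ᴴ) :
    broadcastGap (dephase A) = -coherence (gram K) := by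
  have hb : ∀ i, block (dephase A) i i = K i * (K i)ᴴ := fun i => by
    rw [block_dephase, if_pos rfl, h1]
  rw [broadcastGap_of_block_eq_zero]
  · simp only [hb, coherence, block_gram, vnEnt_gram, vnEnt_mul_conjTranspose_self]
    ring
  · intro i; rw [hb]; exact posSemidef_self_mul_conjTranspose _
  · intro i j hij; rw [block_dephase, if_neg hij]

end Embed

/-! ### The model -/

namespace CentralModel

variable {dS m l : ℕ} {dE : Fin m ⊕ Fin l → ℕ} (𝓜 : CentralModel dS m l dE) (t : ℝ)

theorem conjTranspose_localU_mul (i : Fin dS) (k : Fin m ⊕ Fin l) :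
    (𝓜.localU t i k)ᴴ * 𝓜.localU t i k = 1 := by
  have h : (𝓜.localU t i k)ᴴ = NormedSpace.exp (-((-Complex.I * 𝓜.a i * t) • 𝓜.B k)) := by
    rw [localU, ← Matrix.exp_conjTranspose, conjTranspose_smul, (𝓜.B_hermitian k).eq, ← neg_smul]
    congr 2
    simp
  have hc : Commute (-((-Complex.I * 𝓜.a i * t) • 𝓜.B k)) ((-Complex.I * 𝓜.a i * t) • 𝓜.B k) :=
    (Commute.refl _).neg_left
  rw [h, localU, ← Matrix.exp_add_of_commute _ _ hc, neg_add_cancel, NormedSpace.exp_zero]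

theorem globalState_apply (i j : Fin dS) (x y : ∀ k, Fin (dE k)) :
    𝓜.globalState t (i, x) (j, y) = 𝓜.ρS i j * tensor (𝓜.envOp t i j) x y := by
  have h : 𝓜.globalState t = ∑ i, ∑ j, (ketBra i i * 𝓜.ρS * ketBra j j) ⊗ₖ
      tensor (𝓜.envOp t i j) := by
    have h2 : ∀ i j, tensor (𝓜.envOp t i j) =
        tensor (𝓜.localU t i) * tensor 𝓜.ρE * (tensor (𝓜.localU t j))ᴴ := fun i j => by
      rw [conjTranspose_tensor, tensor_mul, tensor_mul]; rfl
    have h3 : ∀ j : Fin dS, (ketBra j j)ᴴ = ketBra j j := fun j => by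
      simp [ketBra, conjTranspose_single]
    simp only [globalState, evolution, conjTranspose_sum, conjTranspose_kronecker, h2, h3,
      Finset.sum_mul, Finset.mul_sum, mul_kronecker_mul]
    exact Finset.sum_comm
  rw [h]
  simp only [Matrix.sum_apply, kroneckerMap_apply, ketBra]
  rw [Finset.sum_eq_single i, Finset.sum_eq_single j]
  · simp
  · intro b _ hb; simp [hb]
  · simp
  · intro b _ hb
    refine Finset.sum_eq_zero fun c _ => ?_
    rw [mul_assoc, single_mul_apply_of_ne _ _ _ _ _ hb.symm, zero_mul]
  · simp

theorem block_obsState (i j : Fin dS) :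
    block (𝓜.obsState t) i j =
      (𝓜.ρS i j * ∏ k : Fin l, (𝓜.envOp t i j (Sum.inr k)).trace) •
        tensor fun k : Fin m => 𝓜.envOp t i j (Sum.inl k) := by
  ext x y
  have : ∏ k : Fin l, (𝓜.envOp t i j (Sum.inr k)).trace =
      ∑ z : ∀ k : Fin l, Fin (dE (Sum.inr k)), ∏ k, 𝓜.envOp t i j (Sum.inr k) (z k) (z k) := by
    rw [← trace_tensor]; rfl
  simp only [block, submatrix_apply, obsState, of_apply, globalState_apply, Matrix.smul_apply, this,
    smul_eq_mul, Finset.mul_sum, Finset.sum_mul]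
  refine Finset.sum_congr rfl fun z _ => ?_
  simp only [tensor, of_apply, Fintype.prod_sum_type]
  have h1 : ∀ k, (Equiv.sumPiEquivProdPi fun k => Fin (dE k)).symm (x, z) (Sum.inl k) = x k :=
    fun _ => rfl
  have h2 : ∀ k, (Equiv.sumPiEquivProdPi fun k => Fin (dE k)).symm (y, z) (Sum.inl k) = y k :=
    fun _ => rfl
  have h3 : ∀ x k, (Equiv.sumPiEquivProdPi fun k => Fin (dE k)).symm (x, z) (Sum.inr k) = z k :=
    fun _ _ => rfl
  simp only [h1, h2, h3]
  ring

theorem envState_posSemidef (i : Fin dS) (k : Fin m ⊕ Fin l) :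
    (𝓜.envState t i k).PosSemidef :=
  (𝓜.ρE_isState k).1.mul_mul_conjTranspose_same _

theorem trace_envState (i : Fin dS) (k : Fin m ⊕ Fin l) : (𝓜.envState t i k).trace = 1 := by
  rw [envState, envOp, trace_mul_comm, ← mul_assoc, conjTranspose_localU_mul, one_mul,
    (𝓜.ρE_isState k).2]

theorem ofReal_σ (i : Fin dS) : (𝓜.σ i : ℂ) = 𝓜.ρS i i :=
  Complex.conj_eq_iff_re.1 (𝓜.ρS_isState.1.1.apply i i)

theorem σ_nonneg (i : Fin dS) : 0 ≤ 𝓜.σ i := re_diag_nonneg 𝓜.ρS_isState.1 i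

theorem sum_σ : ∑ i, 𝓜.σ i = 1 := by
  have := congrArg Complex.re 𝓜.ρS_isState.2
  rwa [trace_re] at this

theorem block_obsState_self (i : Fin dS) :
    block (𝓜.obsState t) i i =
      (𝓜.σ i : ℂ) • tensor fun k : Fin m => 𝓜.envState t i (Sum.inl k) := by
  have : ∀ k, (𝓜.envOp t i i k).trace = 1 := 𝓜.trace_envState t i
  rw [block_obsState, ofReal_σ]
  simp only [this, Finset.prod_const_one, mul_one]
  rfl

theorem trace_block_obsState (i : Fin dS) : (block (𝓜.obsState t) i i).trace = 𝓜.σ i := by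
  rw [block_obsState_self, trace_smul, trace_tensor]
  simp [trace_envState]

theorem obsState_isState : IsState (𝓜.obsState t) := by
  constructor
  · have : 𝓜.obsState t = ∑ z : (∀ k : Fin l, Fin (dE (Sum.inr k))),
        (𝓜.globalState t).submatrix
          (fun p => (p.1, (Equiv.sumPiEquivProdPi fun k => Fin (dE k)).symm (p.2, z)))
          (fun p => (p.1, (Equiv.sumPiEquivProdPi fun k => Fin (dE k)).symm (p.2, z))) := by
      ext p q
      simp [obsState, Matrix.sum_apply]
    rw [this]
    refine posSemidef_sum _ fun z _ => PosSemidef.submatrix ?_ _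
    exact (𝓜.ρS_isState.1.kronecker
      (tensor_posSemidef fun k => (𝓜.ρE_isState k).1)).mul_mul_conjTranspose_same _
  · rw [← sum_trace_block]
    simp only [trace_block_obsState, ← Complex.ofReal_sum, sum_σ, Complex.ofReal_one]

theorem mutualInformation_sub_pointerEntropy :
    mutualInformation (𝓜.obsState t) - 𝓜.pointerEntropy =
      broadcastGap (𝓜.obsState t) / log 2 := by
  simp only [mutualInformation, vonNeumannEntropy, pointerEntropy, shannonEntropy, broadcastGap,
    traceRight_apply_self, trace_block_obsState, Complex.ofReal_re, vnEnt]
  ring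

theorem abs_broadcastGap_obsState_le : |broadcastGap (𝓜.obsState t)| ≤ 2 * log dS := by
  have h := 𝓜.obsState_isState t
  have h1 := broadcastGap_le h.1
  have h2 := le_broadcastGap h.1
  have h3 := Real.log_natCast_nonneg dS
  simp only [h.2, Complex.one_re, Fintype.card_fin] at h1 h2
  rw [abs_le]
  constructor <;> linarith

/-! ### The bound in terms of decoherence and fidelities -/

/-- The block is a scalar c times W_i W_jᴴ, where W_i is the tensor product of the U_i V with ρ = V
Vᴴ, and tr W_i W_iᴴ = 1. Only |c| survives in the traces. -/
theorem block_obsState_factorization {i j : Fin dS} :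
    ∃ L R, block (𝓜.obsState t) i j = L * Rᴴ ∧
      (L * Lᴴ).trace.re ≤
        ‖𝓜.ρS i j‖ * ∏ k : Fin l, ‖(𝓜.envOp t i j (Sum.inr k)).trace‖ ∧
      (R * Rᴴ).trace.re ≤
        ‖𝓜.ρS i j‖ * ∏ k : Fin l, ‖(𝓜.envOp t i j (Sum.inr k)).trace‖ := by
  choose V hV using fun k => exists_eq_mul_conjTranspose (𝓜.ρE_isState k).1
  set c : ℂ := 𝓜.ρS i j * ∏ k : Fin l, (𝓜.envOp t i j (Sum.inr k)).trace with hc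
  have hn : ‖𝓜.ρS i j‖ * ∏ k : Fin l, ‖(𝓜.envOp t i j (Sum.inr k)).trace‖ = ‖c‖ := by
    rw [hc, norm_mul, norm_prod]
  set W : Fin dS → Matrix (∀ k : Fin m, Fin (dE (Sum.inl k))) _ ℂ :=
    fun i => tensor fun k : Fin m => 𝓜.localU t i (Sum.inl k) * V (Sum.inl k) with hW
  have hWW : ∀ i j, W i * (W j)ᴴ = tensor fun k : Fin m => 𝓜.envOp t i j (Sum.inl k) := by
    intro i j
    simp only [hW, conjTranspose_tensor, tensor_mul, envOp, conjTranspose_mul]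
    congr 1; ext1 k
    conv_rhs => rw [hV]
    simp only [mul_assoc]
  have htr : ∀ i, (W i * (W i)ᴴ).trace = 1 := fun i => by
    rw [hWW, trace_tensor]
    exact Finset.prod_eq_one fun k _ => 𝓜.trace_envState t i _
  rw [hn, block_obsState, ← hc]
  -- The phase of c goes to the left factor, √|c| to each; for c = 0 the quotient is 0.
  refine ⟨(c / (√‖c‖ : ℝ)) • W i, ((√‖c‖ : ℝ) : ℂ) • W j, ?_, ?_, ?_⟩
  · rw [conjTranspose_smul, smul_mul, mul_smul_comm, smul_smul, hWW]
    congr 1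
    rcases eq_or_ne c 0 with h | h
    · simp [h]
    · have h0 : ((√‖c‖ : ℝ) : ℂ) ≠ 0 := by
        have := norm_pos_iff.2 h
        exact_mod_cast (Real.sqrt_pos.2 this).ne'
      rw [Complex.star_def, Complex.conj_ofReal, div_mul_cancel₀ _ h0]
  · rw [conjTranspose_smul, smul_mul, mul_smul_comm, smul_smul, trace_smul, htr, smul_eq_mul,
      mul_one, Complex.star_def, Complex.mul_conj, Complex.normSq_eq_norm_sq, Complex.ofReal_re,
      norm_div, Complex.norm_real, Real.norm_of_nonneg (Real.sqrt_nonneg _), div_pow,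
      Real.sq_sqrt (norm_nonneg _)]
    rcases eq_or_ne c 0 with h | h
    · simp [h]
    · have := norm_pos_iff.2 h
      apply le_of_eq; field_simp
  · rw [conjTranspose_smul, smul_mul, mul_smul_comm, smul_smul, trace_smul, htr, smul_eq_mul,
      mul_one, Complex.star_def, Complex.conj_ofReal, ← Complex.ofReal_mul, Complex.ofReal_re,
      Real.mul_self_sqrt (norm_nonneg _)]

/-- The square roots `√(σᵢ ⨂ₖ ρᵢ⁽ᵏ⁾)` of the conditional states of the observed environments. -/
def rootState (i : Fin dS) :
    Matrix (∀ k : Fin m, Fin (dE (Sum.inl k))) (∀ k : Fin m, Fin (dE (Sum.inl k))) ℂ :=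
  ((√(𝓜.σ i) : ℝ) : ℂ) • tensor fun k : Fin m => cfc Real.sqrt (𝓜.envState t i (Sum.inl k))

theorem conjTranspose_rootState (i : Fin dS) : (𝓜.rootState t i)ᴴ = 𝓜.rootState t i := by
  simp [rootState, conjTranspose_smul, conjTranspose_tensor,
    conjTranspose_cfc_sqrt (𝓜.envState_posSemidef t i _)]

theorem rootState_mul (i j : Fin dS) :
    𝓜.rootState t i * 𝓜.rootState t j = ((√(𝓜.σ i * 𝓜.σ j) : ℝ) : ℂ) •
      tensor fun k : Fin m => cfc Real.sqrt (𝓜.envState t i (Sum.inl k)) *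
        cfc Real.sqrt (𝓜.envState t j (Sum.inl k)) := by
  rw [rootState, rootState, smul_mul, mul_smul_comm, smul_smul, tensor_mul, ← Complex.ofReal_mul,
    Real.sqrt_mul (𝓜.σ_nonneg i)]

theorem rootState_mul_self (i : Fin dS) :
    𝓜.rootState t i * 𝓜.rootState t i = block (𝓜.obsState t) i i := by
  rw [rootState_mul, block_obsState_self, Real.sqrt_mul_self (𝓜.σ_nonneg i)]
  simp only [cfc_sqrt_mul_self (𝓜.envState_posSemidef t i _)]

/-- Only environment `k₀` gets the balanced singular value factorisation; each other one keeps √ρ_i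
√ρ_j, whose factors have squares of trace 1. Thus a single fidelity controls the whole tensor
product. -/
theorem rootState_mul_factorization (k₀ : Fin m) (i j : Fin dS) :
    ∃ L R, 𝓜.rootState t i * 𝓜.rootState t j = L * Rᴴ ∧
      (L * Lᴴ).trace.re = √(𝓜.σ i * 𝓜.σ j) *
        fidelity (𝓜.envState t i (Sum.inl k₀)) (𝓜.envState t j (Sum.inl k₀)) ∧
      (R * Rᴴ).trace.re = √(𝓜.σ i * 𝓜.σ j) *
        fidelity (𝓜.envState t i (Sum.inl k₀)) (𝓜.envState t j (Sum.inl k₀)) := by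
  set b := fidelity (𝓜.envState t i (Sum.inl k₀)) (𝓜.envState t j (Sum.inl k₀)) with hb
  have hk : ∀ k : Fin m, ∃ L R : Matrix (Fin (dE (Sum.inl k))) (Fin (dE (Sum.inl k))) ℂ,
      cfc Real.sqrt (𝓜.envState t i (Sum.inl k)) * cfc Real.sqrt (𝓜.envState t j (Sum.inl k)) =
        L * Rᴴ ∧ (L * Lᴴ).trace = ((if k = k₀ then b else 1 : ℝ) : ℂ) ∧
        (R * Rᴴ).trace = ((if k = k₀ then b else 1 : ℝ) : ℂ) := by
    intro k
    split_ifs with h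
    · subst h
      obtain ⟨L, R, h, hL, hR⟩ := exists_traceNorm_factorization
        (cfc Real.sqrt (𝓜.envState t i (Sum.inl k)) * cfc Real.sqrt (𝓜.envState t j (Sum.inl k)))
      refine ⟨L, R, h, ?_, ?_⟩
      · rw [hb, fidelity, ← hL]
        exact (ofReal_trace_re (isHermitian_mul_conjTranspose_self L)).symm
      · rw [hb, fidelity, ← hR]
        exact (ofReal_trace_re (isHermitian_mul_conjTranspose_self R)).symm
    · refine ⟨cfc Real.sqrt (𝓜.envState t i (Sum.inl k)),
        cfc Real.sqrt (𝓜.envState t j (Sum.inl k)), ?_, ?_, ?_⟩ <;>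
      simp only [conjTranspose_cfc_sqrt (𝓜.envState_posSemidef t _ _),
        cfc_sqrt_mul_self (𝓜.envState_posSemidef t _ _), trace_envState, Complex.ofReal_one]
  choose L R h hL hR using hk
  set w := √(𝓜.σ i * 𝓜.σ j) with hw
  have hww : ((√w : ℝ) : ℂ) * (√w : ℝ) = w := by
    rw [← Complex.ofReal_mul, Real.mul_self_sqrt (Real.sqrt_nonneg _)]
  have hprod : ∏ k, ((if k = k₀ then b else 1 : ℝ) : ℂ) = b := by
    rw [Finset.prod_eq_single k₀] <;> simp +contextual
  refine ⟨((√w : ℝ) : ℂ) • tensor L, ((√w : ℝ) : ℂ) • tensor R, ?_, ?_, ?_⟩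
  · rw [rootState_mul, conjTranspose_smul, smul_mul, mul_smul_comm, smul_smul, Complex.star_def,
      Complex.conj_ofReal, hww, conjTranspose_tensor, tensor_mul]
    simp only [h]
    rfl
  · rw [conjTranspose_smul, smul_mul, mul_smul_comm, smul_smul, Complex.star_def,
      Complex.conj_ofReal, hww, conjTranspose_tensor, tensor_mul, trace_smul, trace_tensor]
    simp only [hL, hprod, smul_eq_mul, ← Complex.ofReal_mul, Complex.ofReal_re]
  · rw [conjTranspose_smul, smul_mul, mul_smul_comm, smul_smul, Complex.star_def,
      Complex.conj_ofReal, hww, conjTranspose_tensor, tensor_mul, trace_smul, trace_tensor]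
    simp only [hR, hprod, smul_eq_mul, ← Complex.ofReal_mul, Complex.ofReal_re]

theorem Gam_nonneg : 0 ≤ 𝓜.Gam t :=
  Finset.sum_nonneg fun i _ => Finset.sum_nonneg fun j _ => by split_ifs <;> positivity

theorem Gam_le_eta : 𝓜.Gam t ≤ 𝓜.eta t :=
  le_add_of_nonneg_right <| Finset.sum_nonneg fun i _ => Finset.sum_nonneg fun j _ => by
    split_ifs
    · rfl
    · exact mul_nonneg (Real.sqrt_nonneg _) (Finset.sum_nonneg fun k _ => fidelity_nonneg _ _)

/-- Two comparisons with the dephased state: ρ(t) through the gap, at distance Γ/2, and the Gram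
state of the roots through the coherence, at distance (η - Γ)/2. Their defect constants 4 and 2 add
up to 6. -/
theorem abs_broadcastGap_le_eta (hm : 0 < m) :
    |broadcastGap (𝓜.obsState t)| ≤ 6 * defect 1 (𝓜.eta t) + 3 * log dS * 𝓜.eta t := by
  have hρ := 𝓜.obsState_isState t
  have hpsd : ∀ i, (block (dephase (𝓜.obsState t)) i i).PosSemidef := fun i => by
    rw [block_dephase, if_pos rfl]; exact block_posSemidef hρ.1 i
  have hoff : ∀ i j, i ≠ j → block (dephase (𝓜.obsState t)) i j = 0 := fun i j hij => by
    rw [block_dephase, if_neg hij]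
  have hdeph : IsState (dephase (𝓜.obsState t)) := isState_of_block hpsd hoff (by
    simp only [block_dephase, if_true]
    rw [sum_trace_block, hρ.2])
  have hK : ∀ i, block (𝓜.obsState t) i i = 𝓜.rootState t i * (𝓜.rootState t i)ᴴ := fun i => by
    rw [conjTranspose_rootState, rootState_mul_self]
  have hgram : ∀ i j, block (gram (𝓜.rootState t)) i j = 𝓜.rootState t i * 𝓜.rootState t j :=
    fun i j => by rw [block_gram, conjTranspose_rootState]
  have hT : IsState (gram (𝓜.rootState t)) := ⟨gram_posSemidef _, by
    rw [← sum_trace_block]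
    simp only [hgram, rootState_mul_self]
    rw [sum_trace_block, hρ.2]⟩
  obtain ⟨L, R, h, hx⟩ := exists_embed_decomposition (𝓜.obsState t - dephase (𝓜.obsState t))
    (fun i j => ‖𝓜.ρS i j‖ * ∏ k : Fin l, ‖(𝓜.envOp t i j (Sum.inr k)).trace‖)
    (fun i => by
      change block (𝓜.obsState t) i i - block (dephase (𝓜.obsState t)) i i = 0
      rw [block_dephase, if_pos rfl, sub_self])
    (fun i j hij => by
      have : block (𝓜.obsState t - dephase (𝓜.obsState t)) i j = block (𝓜.obsState t) i j := by
        change block (𝓜.obsState t) i j - block (dephase (𝓜.obsState t)) i j = _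
        rw [hoff i j hij, sub_zero]
      rw [this]
      exact 𝓜.block_obsState_factorization t)
  have h1 := abs_broadcastGap_sub_le hρ hdeph L R h (x := 𝓜.Gam t / 2)
    (hx.trans_eq (by rw [Gam]; ring))
  obtain ⟨L', R', h', hx'⟩ := exists_embed_decomposition
    (gram (𝓜.rootState t) - dephase (𝓜.obsState t))
    (fun i j => √(𝓜.σ i * 𝓜.σ j) *
      ∑ k : Fin m, fidelity (𝓜.envState t i (Sum.inl k)) (𝓜.envState t j (Sum.inl k)))
    (fun i => by
      change block (gram (𝓜.rootState t)) i i - block (dephase (𝓜.obsState t)) i i = 0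
      rw [block_dephase, if_pos rfl, hgram, rootState_mul_self, sub_self])
    (fun i j hij => by
      have : block (gram (𝓜.rootState t) - dephase (𝓜.obsState t)) i j =
          𝓜.rootState t i * 𝓜.rootState t j := by
        change block (gram (𝓜.rootState t)) i j - block (dephase (𝓜.obsState t)) i j = _
        rw [hoff i j hij, sub_zero, hgram]
      rw [this]
      obtain ⟨L, R, h, hL, hR⟩ := 𝓜.rootState_mul_factorization t ⟨0, hm⟩ i j
      -- The fidelity of one observed environment is at most the sum appearing in η.
      have hle := mul_le_mul_of_nonneg_left (Finset.single_le_sum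
        (f := fun k : Fin m => fidelity (𝓜.envState t i (Sum.inl k)) (𝓜.envState t j (Sum.inl k)))
        (fun k _ => fidelity_nonneg _ _) (Finset.mem_univ ⟨0, hm⟩))
        (Real.sqrt_nonneg (𝓜.σ i * 𝓜.σ j))
      exact ⟨L, R, h, hL.trans_le hle, hR.trans_le hle⟩)
  have h2 := abs_coherence_sub_le hT hdeph L' R' h' (x := (𝓜.eta t - 𝓜.Gam t) / 2)
    (hx'.trans_eq (by rw [eta]; ring))
  rw [coherence_eq_zero hpsd hoff, sub_zero] at h2
  rw [broadcastGap_dephase _ hK, sub_neg_eq_add] at h1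
  have hG := 𝓜.Gam_nonneg t
  have hη := 𝓜.Gam_le_eta t
  have hd1 := defect_mono_right zero_le_one (by linarith : 0 ≤ 𝓜.Gam t / 2)
    (by linarith : 𝓜.Gam t / 2 ≤ 𝓜.eta t)
  have hd2 := defect_mono_right zero_le_one (by linarith : 0 ≤ (𝓜.eta t - 𝓜.Gam t) / 2)
    (by linarith : (𝓜.eta t - 𝓜.Gam t) / 2 ≤ 𝓜.eta t)
  rw [Fintype.card_fin] at h1 h2
  have hlog := Real.log_natCast_nonneg dS
  have p1 := mul_le_mul_of_nonneg_left (by linarith : 𝓜.Gam t / 2 ≤ 𝓜.eta t) hlog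
  have p2 := mul_le_mul_of_nonneg_left hη hlog
  have p3 := mul_nonneg hlog hG
  rw [abs_le] at *
  constructor <;> linarith

end CentralModel


/-! ### Elementary estimates -/

/-- The difference is (1+x) log(1+x) + (1-x) log(1-x), bounded through log u ≤ u - 1. -/
theorem defect_one_le_binEntropy_add {x : ℝ} (h0 : 0 ≤ x) (h1 : x < 1) :
    defect 1 x ≤ binEntropy x + 2 * x ^ 2 := by
  have e1 := log_le_sub_one_of_pos (x := 1 + x) (by linarith)
  have e2 := log_le_sub_one_of_pos (x := 1 - x) (by linarith)
  have p1 := mul_le_mul_of_nonneg_left e1 (by linarith : 0 ≤ 1 + x)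
  have p2 := mul_le_mul_of_nonneg_left e2 (by linarith : 0 ≤ 1 - x)
  rw [binEntropy_eq_negMulLog_add_negMulLog_one_sub]
  simp only [defect, negMulLog, log_one]
  linarith

theorem F_mul_log_two (d : ℕ) (x : ℝ) :
    F d x * log 2 = 4 * binEntropy (2 * x) + 2 * binEntropy x + 10 * x * log d := by
  have : log 2 ≠ 0 := (log_pos one_lt_two).ne'
  simp only [F, binaryEntropy, logb]
  field_simp

theorem abs_div_log_two_le_F {d : ℕ} {g x : ℝ} (hx0 : 0 ≤ x) (hx1 : x ≤ 1 / 2)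
    (h1 : |g| ≤ 2 * log d) (h2 : |g| ≤ 6 * defect 1 x + 3 * log d * x) :
    |g / log 2| ≤ F d x := by
  have hl2 : 0 < log 2 := log_pos one_lt_two
  have hl2' : 0.69 < log 2 := by have := log_two_gt_d9; linarith
  rw [abs_div, abs_of_pos hl2, div_le_iff₀ hl2, F_mul_log_two]
  have hlog := log_natCast_nonneg d
  have b1 : 0 ≤ binEntropy (2 * x) := binEntropy_nonneg (by linarith) (by linarith)
  have b2 : 0 ≤ binEntropy x := binEntropy_nonneg (by linarith) (by linarith)
  -- From x = 1/5 on, 10 x log d already exceeds the trivial bound 2 log d. Below it h(x) ≤ h(2x),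
  -- and the remainder 12x² ≤ 12x/5 is absorbed by 7x log d when d ≥ 2.
  rcases le_or_gt (1 / 5) x with hx | hx
  · have := mul_le_mul_of_nonneg_right hx hlog
    linarith
  · rcases le_or_gt d 1 with hd | hd
    · have : log d = 0 := by interval_cases d <;> simp
      rw [this] at h1 ⊢
      linarith
    · have hd' : log 2 ≤ log d := log_le_log two_pos (by exact_mod_cast hd)
      have hmono : binEntropy x ≤ binEntropy (2 * x) :=
        binEntropy_strictMonoOn.monotoneOn ⟨hx0, by norm_num; linarith⟩
          ⟨by linarith, by norm_num; linarith⟩ (by linarith)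
      have hdef := defect_one_le_binEntropy_add hx0 (by linarith)
      have q1 := mul_le_mul_of_nonneg_left hx.le hx0
      have q2 := mul_le_mul_of_nonneg_left (hl2'.le.trans hd') hx0
      nlinarith

theorem continuous_F (d : ℕ) : Continuous (F d) := by
  unfold F binaryEntropy
  have := binEntropy_continuous
  fun_prop

/-! ### Projections -/

section Projection

variable {n : Type*} [Fintype n] [DecidableEq n]

theorem re_trace_mul_nonneg_of_isStarProjection {Q A : Matrix n n ℂ} (hQ : IsStarProjection Q)
    (hA : A.PosSemidef) : 0 ≤ (Q * A).trace.re := by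
  have h1 : Qᴴ = Q := hQ.isSelfAdjoint
  have : (Q * A).trace = (Q * A * Qᴴ).trace := by
    rw [trace_mul_comm (Q * A), h1, ← mul_assoc, hQ.isIdempotentElem]
  rw [this]
  exact re_trace_nonneg (hA.mul_mul_conjTranspose_same Q)

theorem re_trace_mul_le_of_isStarProjection {Q A : Matrix n n ℂ} (hQ : IsStarProjection Q)
    (hA : A.PosSemidef) : (Q * A).trace.re ≤ A.trace.re := by
  have := re_trace_mul_nonneg_of_isStarProjection hQ.one_sub hA
  rw [Matrix.sub_mul, one_mul, trace_sub, Complex.sub_re] at this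
  linarith

/-- The conditions are closed, and P = P² = Pᴴ gives P_xx = Σ_y |P_xy|², which bounds all entries by
1. -/
theorem isCompact_setOf_isProjectiveMeasurement {I : Type*} [Fintype I] :
    IsCompact {P : I → Matrix n n ℂ | IsProjectiveMeasurement P} := by
  have hK : IsCompact {P : I → Matrix n n ℂ | ∀ i x y, P i x y ∈ Metric.closedBall (0 : ℂ) 1} := by
    have : {P : I → Matrix n n ℂ | ∀ i x y, P i x y ∈ Metric.closedBall (0 : ℂ) 1} =
        Set.univ.pi fun _ => (Set.univ.pi fun _ => Set.univ.pi fun _ =>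
          Metric.closedBall (0 : ℂ) 1 : Set (n → n → ℂ)) := by
      ext P
      exact ⟨fun h i _ x _ y _ => h i x y, fun h i x y => h i trivial x trivial y trivial⟩
    rw [this]
    exact isCompact_univ_pi fun _ => isCompact_univ_pi fun _ => isCompact_univ_pi fun _ =>
      isCompact_closedBall _ _
  refine hK.of_isClosed_subset ?_ ?_
  · simp only [IsProjectiveMeasurement, isStarProjection_iff, IsIdempotentElem, IsSelfAdjoint,
      Set.ofPred_and, Set.ofPred_forall]
    refine (isClosed_iInter fun i => (isClosed_eq ?_ ?_).inter (isClosed_eq ?_ ?_)).inter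
      ((isClosed_iInter fun i => isClosed_iInter fun j => isClosed_iInter fun _ =>
        isClosed_eq ?_ ?_).inter (isClosed_eq ?_ ?_)) <;> fun_prop
  · intro P hP i x y
    have h1 : (P i)ᴴ = P i := (hP.1 i).isSelfAdjoint
    have h2 : P i * P i = P i := (hP.1 i).isIdempotentElem
    have hsum : (P i x x).re = ∑ y, ‖P i x y‖ ^ 2 := by
      conv_lhs => rw [← h2, mul_apply, Complex.re_sum]
      refine Finset.sum_congr rfl fun y _ => ?_
      have hyx : P i y x = (starRingEnd ℂ) (P i x y) := (congrFun (congrFun h1 y) x).symm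
      rw [hyx, Complex.mul_conj, Complex.normSq_eq_norm_sq, Complex.ofReal_re]
    have hle : ∀ y, ‖P i x y‖ ^ 2 ≤ (P i x x).re := fun y => by
      rw [hsum]
      exact Finset.single_le_sum (f := fun y => ‖P i x y‖ ^ 2) (fun _ _ => sq_nonneg _)
        (Finset.mem_univ y)
    have hre := Complex.re_le_norm (P i x x)
    have h3 := hle x
    have h4 := hle y
    have h5 := norm_nonneg (P i x x)
    have h6 := norm_nonneg (P i x y)
    rw [mem_closedBall_zero_iff]
    have h7 : ‖P i x x‖ ≤ 1 := by nlinarith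
    nlinarith

end Projection

namespace CentralModel

variable {dS m l : ℕ} {dE : Fin m ⊕ Fin l → ℕ} (𝓜 : CentralModel dS m l dE) (t : ℝ)
  {P : LocalOperators dS m l dE}

/-! ### The spectrum broadcast structure -/

theorem projected_posSemidef {k : Fin m} (hP : IsProjectiveMeasurement (P k)) (i : Fin dS) :
    (𝓜.projected t P i k).PosSemidef := by
  have h : (P k i)ᴴ = P k i := (hP.1 i).isSelfAdjoint
  have := (𝓜.envState_posSemidef t i (Sum.inl k)).mul_mul_conjTranspose_same (P k i)
  rwa [h] at this

theorem ofReal_prob {k : Fin m} (hP : IsProjectiveMeasurement (P k)) (i : Fin dS) :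
    (𝓜.prob t P i k : ℂ) = (𝓜.projected t P i k).trace :=
  ofReal_trace_re (𝓜.projected_posSemidef t hP i).1

theorem trace_mul_envState {k : Fin m} (hP : IsProjectiveMeasurement (P k)) (i : Fin dS) :
    (P k i * 𝓜.envState t i (Sum.inl k)).trace = 𝓜.prob t P i k := by
  rw [ofReal_prob _ _ hP, projected, trace_mul_comm (P k i * _), ← mul_assoc,
    (hP.1 i).isIdempotentElem]

theorem trace_mul_projected {k : Fin m} (hP : IsProjectiveMeasurement (P k)) (i : Fin dS) :
    (P k i * 𝓜.projected t P i k).trace = 𝓜.prob t P i k := by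
  rw [ofReal_prob _ _ hP, projected, ← mul_assoc, ← mul_assoc, (hP.1 i).isIdempotentElem]

theorem success_nonneg (hP : ∀ k, IsProjectiveMeasurement (P k)) : 0 ≤ 𝓜.success t P :=
  Finset.sum_nonneg fun i _ => mul_nonneg (𝓜.σ_nonneg i) <| Finset.prod_nonneg fun k _ =>
    re_trace_nonneg (𝓜.projected_posSemidef t (hP k) i)

/-- The p_i cancel against r_i; if some p_i vanishes, so does the projected positive matrix. The
only remaining denominator is the success probability, as continuity in P requires. -/
theorem sbsState_eq (hP : ∀ k, IsProjectiveMeasurement (P k)) :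
    𝓜.sbsState t P = ∑ i, ((𝓜.σ i / 𝓜.success t P : ℝ) : ℂ) •
      (ketBra i i ⊗ₖ tensor fun k => 𝓜.projected t P i k) := by
  refine Finset.sum_congr rfl fun i _ => ?_
  rw [tensor_smul (fun k => ((𝓜.prob t P i k : ℂ))⁻¹), kronecker_smul, smul_smul]
  by_cases h : ∃ k, 𝓜.prob t P i k = 0
  · obtain ⟨k, hk⟩ := h
    have h0 : 𝓜.projected t P i k = 0 := by
      rw [← (𝓜.projected_posSemidef t (hP k) i).trace_eq_zero_iff, ← ofReal_prob _ _ (hP k), hk,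
        Complex.ofReal_zero]
    rw [tensor_eq_zero _ k h0]
    simp
  · push Not at h
    have hr : 𝓜.r t P i ≠ 0 := Finset.prod_ne_zero_iff.2 fun k _ => h k
    congr 1
    rw [Finset.prod_inv_distrib, ← Complex.ofReal_prod, ← Complex.ofReal_inv, ← Complex.ofReal_mul]
    change ((𝓜.σ i * 𝓜.r t P i / 𝓜.success t P * (𝓜.r t P i)⁻¹ : ℝ) : ℂ) = _
    congr 1
    field_simp

theorem block_sbsState (hP : ∀ k, IsProjectiveMeasurement (P k)) (i j : Fin dS) :
    block (𝓜.sbsState t P) i j = if i = j then ((𝓜.σ i / 𝓜.success t P : ℝ) : ℂ) •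
      tensor fun k => 𝓜.projected t P i k else 0 := by
  rw [sbsState_eq _ _ hP]
  ext x y
  simp only [block, submatrix_apply, Matrix.sum_apply, Matrix.smul_apply, kroneckerMap_apply,
    ketBra]
  rw [Finset.sum_eq_single i]
  · by_cases h : i = j <;> simp [h]
  · intro b _ hb; simp [hb]
  · simp

theorem block_sbsState_posSemidef (hP : ∀ k, IsProjectiveMeasurement (P k)) (i : Fin dS) :
    (block (𝓜.sbsState t P) i i).PosSemidef := by
  rw [block_sbsState _ _ hP, if_pos rfl]
  refine (tensor_posSemidef fun k => 𝓜.projected_posSemidef t (hP k) i).smul ?_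
  exact_mod_cast div_nonneg (𝓜.σ_nonneg i) (𝓜.success_nonneg t hP)

theorem sum_div_success (hP : 𝓜.Admissible t P) :
    ∑ i, ((𝓜.σ i / 𝓜.success t P : ℝ) : ℂ) * ∏ k, (𝓜.prob t P i k : ℂ) = 1 := by
  have : ∑ i, 𝓜.σ i / 𝓜.success t P * 𝓜.r t P i = 1 := by
    simp only [div_mul_eq_mul_div, ← Finset.sum_div]
    exact div_self hP.2
  exact_mod_cast congrArg ((↑) : ℝ → ℂ) this

theorem sbsState_isState (hP : 𝓜.Admissible t P) : IsState (𝓜.sbsState t P) := by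
  refine isState_of_block (𝓜.block_sbsState_posSemidef t hP.1)
    (fun i j hij => by rw [block_sbsState _ _ hP.1, if_neg hij]) ?_
  rw [← 𝓜.sum_div_success t hP]
  refine Finset.sum_congr rfl fun i _ => ?_
  rw [block_sbsState _ _ hP.1, if_pos rfl, trace_smul, trace_tensor, smul_eq_mul]
  simp only [ofReal_prob _ _ (hP.1 _)]

/-- Orthogonality of the projectors of one observer makes the conditional environment states
orthogonal, so the entropy of their sum is the sum of their entropies. -/
theorem broadcastGap_sbsState (hm : 0 < m) (hP : 𝓜.Admissible t P) :
    broadcastGap (𝓜.sbsState t P) = 0 := by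
  choose V hV using fun i k => exists_eq_mul_conjTranspose (𝓜.envState_posSemidef t i (Sum.inl k))
  have hsa : ∀ k i, (P k i)ᴴ = P k i := fun k i => ((hP.1 k).1 i).isSelfAdjoint
  let K : Fin dS → Matrix (∀ k : Fin m, Fin (dE (Sum.inl k))) _ ℂ := fun i =>
    ((√(𝓜.σ i / 𝓜.success t P) : ℝ) : ℂ) • tensor fun k => P k i * V i k
  have hK : ∀ i, block (𝓜.sbsState t P) i i = K i * (K i)ᴴ := fun i => by
    rw [block_sbsState _ _ hP.1, if_pos rfl]
    simp only [K, conjTranspose_smul, smul_mul, mul_smul_comm, smul_smul, Complex.star_def,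
      Complex.conj_ofReal, conjTranspose_tensor, tensor_mul]
    rw [← Complex.ofReal_mul, Real.mul_self_sqrt
      (div_nonneg (𝓜.σ_nonneg i) (𝓜.success_nonneg t hP.1))]
    congr 2
    ext1 k
    rw [projected, hV, conjTranspose_mul, hsa]
    simp only [mul_assoc]
  have horth : ∀ i j, i ≠ j → (K i)ᴴ * K j = 0 := fun i j hij => by
    simp only [K, conjTranspose_smul, smul_mul, mul_smul_comm, conjTranspose_tensor, tensor_mul]
    rw [tensor_eq_zero _ ⟨0, hm⟩, smul_zero, smul_zero]
    rw [conjTranspose_mul, hsa, mul_assoc, ← mul_assoc (P _ i), (hP.1 _).2.1 i j hij,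
      Matrix.zero_mul, Matrix.mul_zero]
  rw [broadcastGap_of_block_eq_zero (𝓜.block_sbsState_posSemidef t hP.1)
    (fun i j hij => by rw [block_sbsState _ _ hP.1, if_neg hij])]
  simp only [hK]
  rw [vnEnt_sum_eq_of_orthogonal K horth, sub_self]

theorem eps_nonneg : 0 ≤ 𝓜.eps t P :=
  mul_nonneg (by norm_num) (traceNorm_nonneg _)

theorem abs_broadcastGap_le_eps (hm : 0 < m) (hP : 𝓜.Admissible t P) :
    |broadcastGap (𝓜.obsState t)| ≤
      4 * defect 1 (𝓜.eps t P) + 3 * log dS * 𝓜.eps t P := by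
  obtain ⟨L, R, h, hL, hR⟩ := exists_traceNorm_factorization (𝓜.obsState t - 𝓜.sbsState t P)
  have := abs_broadcastGap_sub_le (𝓜.obsState_isState t) (𝓜.sbsState_isState t hP)
    (fun _ : Unit => L) (fun _ => R) (by simpa using h) (x := 𝓜.eps t P)
    (by simp only [Finset.univ_unique, Finset.sum_const, Finset.card_singleton, one_smul, hL, hR,
          eps]; linarith)
  rwa [broadcastGap_sbsState _ _ hm hP, sub_zero, Fintype.card_fin] at this

/-! ### The minimum over the measurements -/

/-- The projection `∑ᵢ |i⟩⟨i| ⊗ ⨂ₖ Pᵢ⁽ᵏ⁾` onto the event that all observers find the pointer. -/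
def jointProjection (P : LocalOperators dS m l dE) :
    Matrix (ObsIndex dS m l dE) (ObsIndex dS m l dE) ℂ :=
  ∑ i, ketBra i i ⊗ₖ tensor fun k => P k i

theorem isStarProjection_jointProjection (hP : ∀ k, IsProjectiveMeasurement (P k)) :
    IsStarProjection (jointProjection P) := by
  refine ⟨?_, ?_⟩
  · rw [IsIdempotentElem, jointProjection, Finset.sum_mul]
    refine Finset.sum_congr rfl fun i _ => ?_
    rw [Finset.mul_sum, Finset.sum_eq_single i]
    · rw [← mul_kronecker_mul, tensor_mul]
      congr 1
      · simp [ketBra]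
      · congr 1; ext1 k; exact ((hP k).1 i).isIdempotentElem
    · intro j _ hj
      rw [← mul_kronecker_mul]
      simp [ketBra, hj.symm]
    · simp
  · have hsa : ∀ k i, (P k i)ᴴ = P k i := fun k i => ((hP k).1 i).isSelfAdjoint
    change (jointProjection P)ᴴ = jointProjection P
    simp [jointProjection, conjTranspose_sum, conjTranspose_kronecker, conjTranspose_tensor, hsa,
      ketBra]

theorem trace_jointProjection_mul (A : Matrix (ObsIndex dS m l dE) (ObsIndex dS m l dE) ℂ) :
    (jointProjection P * A).trace = ∑ i, ((tensor fun k => P k i) * block A i i).trace := by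
  rw [← sum_trace_block]
  refine Finset.sum_congr rfl fun i _ => ?_
  congr 1
  ext x y
  simp only [block, submatrix_apply, mul_apply, Fintype.sum_prod_type, jointProjection,
    Matrix.sum_apply, kroneckerMap_apply, ketBra]
  rw [Finset.sum_eq_single i]
  · refine Finset.sum_congr rfl fun z _ => ?_
    rw [Finset.sum_eq_single i]
    · simp
    · intro b _ hb; simp [hb]
    · simp
  · intro b _ hb
    refine Finset.sum_eq_zero fun z _ => ?_
    rw [Finset.sum_eq_zero, zero_mul]
    intro c _
    rw [single_apply, if_neg, zero_mul]
    rintro ⟨h1, h2⟩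
    exact hb (h2.symm.trans h1)
  · simp

/-- The joint projection has expectation Σ σ_j r_j in ρ(t) and 1 in the broadcast structure;
expectations of a projection in two states differ by at most their trace distance. -/
theorem one_sub_eps_le_success (hP : 𝓜.Admissible t P) :
    1 - 𝓜.eps t P ≤ 𝓜.success t P := by
  have hρ := 𝓜.obsState_isState t
  have hτ := 𝓜.sbsState_isState t hP
  obtain ⟨L, R, h, hL, hR⟩ := exists_traceNorm_factorization (𝓜.obsState t - 𝓜.sbsState t P)
  obtain ⟨X, Y, hX, hY, hXY, ht⟩ := exists_posSemidef_decomposition (hρ.1.1.sub hτ.1.1)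
    (fun _ : Unit => L) (fun _ => R) (by simpa using h)
  simp only [Finset.univ_unique, Finset.sum_const, Finset.card_singleton, one_smul, hL, hR] at ht
  have hXY' : 𝓜.obsState t + X = 𝓜.sbsState t P + Y := by rw [← hXY]; abel
  have htt := congrArg (fun M => (trace M).re) hXY'
  simp only [trace_add, Complex.add_re, hρ.2, hτ.2] at htt
  have hproj := isStarProjection_jointProjection hP.1
  have h1 := congrArg (fun M => (trace (jointProjection P * M)).re) hXY'
  simp only [Matrix.mul_add, trace_add, Complex.add_re] at h1
  have h2 := re_trace_mul_le_of_isStarProjection hproj hX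
  have h3 := re_trace_mul_nonneg_of_isStarProjection hproj hY
  have h4 : (jointProjection P * 𝓜.obsState t).trace = 𝓜.success t P := by
    rw [trace_jointProjection_mul]
    simp only [block_obsState_self, mul_smul_comm, tensor_mul, trace_smul, trace_tensor,
      𝓜.trace_mul_envState t (hP.1 _), success, r, Complex.ofReal_sum, Complex.ofReal_mul,
      Complex.ofReal_prod, smul_eq_mul]
  have h5 : (jointProjection P * 𝓜.sbsState t P).trace = 1 := by
    rw [trace_jointProjection_mul, ← 𝓜.sum_div_success t hP]
    simp only [block_sbsState _ _ hP.1, if_true, mul_smul_comm, tensor_mul, trace_smul,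
      trace_tensor, 𝓜.trace_mul_projected t (hP.1 _), smul_eq_mul]
  rw [h4, h5, Complex.ofReal_re, Complex.one_re] at h1
  unfold eps
  linarith

theorem continuous_projected (i : Fin dS) (k : Fin m) :
    Continuous fun P : LocalOperators dS m l dE => 𝓜.projected t P i k := by
  unfold projected
  fun_prop

theorem continuous_success : Continuous fun P : LocalOperators dS m l dE => 𝓜.success t P := by
  have h : ∀ i k, Continuous fun P : LocalOperators dS m l dE => (𝓜.projected t P i k).trace.re :=
    fun i k => Complex.continuous_re.comp (𝓜.continuous_projected t i k).matrix_trace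
  unfold success r prob
  fun_prop

theorem continuousOn_eps : ContinuousOn (fun P => 𝓜.eps t P)
    {P | (∀ k, IsProjectiveMeasurement (P k)) ∧ 𝓜.success t P ≠ 0} := by
  have hs := 𝓜.continuous_success t
  have ht : ∀ i, Continuous fun P : LocalOperators dS m l dE =>
      tensor fun k => 𝓜.projected t P i k := fun i => by
    refine continuous_matrix fun x y => ?_
    simp only [tensor, of_apply]
    exact continuous_finsetProd _ fun k _ => (𝓜.continuous_projected t i k).matrix_elem _ _
  have hk : ∀ i, Continuous fun P : LocalOperators dS m l dE =>
      (ketBra i i : Matrix (Fin dS) (Fin dS) ℂ) ⊗ₖ tensor fun k => 𝓜.projected t P i k :=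
    fun i => by
      refine continuous_matrix fun x y => ?_
      simp only [kroneckerMap_apply]
      exact continuous_const.mul ((ht i).matrix_elem _ _)
  have h : ContinuousOn (fun P : LocalOperators dS m l dE => 𝓜.obsState t -
      ∑ i, ((𝓜.σ i / 𝓜.success t P : ℝ) : ℂ) •
        (ketBra i i ⊗ₖ tensor fun k => 𝓜.projected t P i k))
      {P | (∀ k, IsProjectiveMeasurement (P k)) ∧ 𝓜.success t P ≠ 0} := by
    refine continuousOn_const.sub (continuousOn_finsetSum _ fun i _ => ?_)
    refine ContinuousOn.fun_smul ?_ (hk i).continuousOn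
    exact Complex.continuous_ofReal.comp_continuousOn
      (continuousOn_const.div hs.continuousOn fun P hP => hP.2)
  refine ((continuous_traceNorm.comp_continuousOn h).const_smul (1 / 2 : ℝ)).congr fun P hP => ?_
  simp only [eps, sbsState_eq _ _ hP.1]
  rfl

/-- The open condition that the success probability be nonzero is replaced by the closed condition
that it be at least 1/2, which ε ≤ 1/2 implies. -/
theorem isCompact_setOf_eps_le :
    IsCompact {P | 𝓜.Admissible t P ∧ 𝓜.eps t P ≤ 1 / 2} := by
  have h1 : IsCompact {P : LocalOperators dS m l dE | ∀ k, IsProjectiveMeasurement (P k)} := by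
    have : {P : LocalOperators dS m l dE | ∀ k, IsProjectiveMeasurement (P k)} =
        Set.univ.pi fun _ => {Q | IsProjectiveMeasurement Q} := by
      ext P; simp [Set.mem_pi]
    rw [this]
    exact isCompact_univ_pi fun k => isCompact_setOf_isProjectiveMeasurement
  have h2 : IsCompact ({P : LocalOperators dS m l dE | ∀ k, IsProjectiveMeasurement (P k)} ∩
      {P | 1 / 2 ≤ 𝓜.success t P}) :=
    h1.inter_right (isClosed_le continuous_const (𝓜.continuous_success t))
  have h3 : ContinuousOn (fun P => 𝓜.eps t P)
      ({P : LocalOperators dS m l dE | ∀ k, IsProjectiveMeasurement (P k)} ∩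
        {P | 1 / 2 ≤ 𝓜.success t P}) :=
    (𝓜.continuousOn_eps t).mono fun P hP =>
      ⟨hP.1, (lt_of_lt_of_le (by norm_num) (show 1 / 2 ≤ 𝓜.success t P from hP.2)).ne'⟩
  have h4 := h3.preimage_isClosed_of_isClosed h2.isClosed (isClosed_Iic (a := (1 / 2 : ℝ)))
  convert h2.of_isClosed_subset h4 Set.inter_subset_left using 1
  ext P
  constructor
  · rintro ⟨hP, he⟩
    have := 𝓜.one_sub_eps_le_success t hP
    exact ⟨⟨hP.1, show 1 / 2 ≤ 𝓜.success t P by linarith⟩, he⟩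
  · rintro ⟨⟨hP, hs⟩, he⟩
    exact ⟨⟨hP, (lt_of_lt_of_le (by norm_num) (show 1 / 2 ≤ 𝓜.success t P from hs)).ne'⟩, he⟩

theorem abs_mutualInformation_sub_le_F_eps (hm : 0 < m) (hP : 𝓜.Admissible t P)
    (he : 𝓜.eps t P ≤ 1 / 2) :
    |mutualInformation (𝓜.obsState t) - 𝓜.pointerEntropy| ≤ F dS (𝓜.eps t P) := by
  rw [mutualInformation_sub_pointerEntropy]
  have h0 := 𝓜.eps_nonneg t (P := P)
  refine abs_div_log_two_le_F h0 he (𝓜.abs_broadcastGap_obsState_le t)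
    ((𝓜.abs_broadcastGap_le_eps t hm hP).trans ?_)
  have := defect_nonneg zero_le_one h0
  linarith

theorem abs_mutualInformation_sub_le_F_eta (hm : 0 < m) (he : 𝓜.eta t ≤ 1 / 2) :
    |mutualInformation (𝓜.obsState t) - 𝓜.pointerEntropy| ≤ F dS (𝓜.eta t) := by
  rw [mutualInformation_sub_pointerEntropy]
  exact abs_div_log_two_le_F ((𝓜.Gam_nonneg t).trans (𝓜.Gam_le_eta t)) he
    (𝓜.abs_broadcastGap_obsState_le t) (𝓜.abs_broadcastGap_le_eta t hm)

end CentralModel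

end Broadcast

end

/-! ### The main theorem. -/

theorem corollary2 (dS m l : ℕ) (hm : 0 < m) (dE : Fin m ⊕ Fin l → ℕ)
    (𝓜 : Broadcast.CentralModel dS m l dE) (t : ℝ) :
    ((∃ P, 𝓜.Admissible t P ∧ 𝓜.eps t P ≤ 1 / 4) →
      ∃ μ : ℝ,
        IsLeast {y : ℝ | ∃ P, 𝓜.Admissible t P ∧ 𝓜.eps t P ≤ 1 / 2 ∧
          y = Broadcast.F dS (𝓜.eps t P)} μ ∧
        |Broadcast.mutualInformation (𝓜.obsState t) - 𝓜.pointerEntropy| ≤ μ) ∧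
    (𝓜.eta t ≤ 1 / 4 →
      |Broadcast.mutualInformation (𝓜.obsState t) - 𝓜.pointerEntropy| ≤
        Broadcast.F dS (𝓜.eta t)) := by
  refine ⟨?_, fun h => 𝓜.abs_mutualInformation_sub_le_F_eta t hm (h.trans (by norm_num))⟩
  rintro ⟨P₀, hP₀, h₀⟩
  obtain ⟨P, ⟨hP, he⟩, hmin⟩ := (𝓜.isCompact_setOf_eps_le t).exists_isMinOn
    ⟨P₀, hP₀, h₀.trans (by norm_num)⟩
    ((Broadcast.continuous_F dS).comp_continuousOn
      ((𝓜.continuousOn_eps t).mono fun Q hQ => hQ.1))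
  refine ⟨Broadcast.F dS (𝓜.eps t P), ⟨⟨P, hP, he, rfl⟩, ?_⟩,
    𝓜.abs_mutualInformation_sub_le_F_eps t hm hP he⟩
  rintro y ⟨Q, hQ, hQe, rfl⟩
  exact hmin ⟨hQ, hQe⟩
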